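/- For a finite graph $G$ on $n\ge 2$ vertices let $\lambda_1(G)\ge\lambda_2(G)\ge\cdots\ge\lambda_n(G)$ be the eigenvalues of its adjacency matrix, with multiplicity; the second eigenvalue multiplicity of $G$ is the number of $j$ with $\lambda_j(G)=\lambda_2(G)$. There exist infinitely many connected $n$-vertex graphs with maximum degree $4$ and second eigenvalue multiplicity at least $\sqrt{n/\log_2 n}$; that is, such a graph exists for infinitely many $n$. Such graphs are constructed as follows. Let $q\ge 4$ be a prime power and let $\Gamma=\mathbb F_q^\times\ltimes\mathbb F_q$, where $\mathbb F_q^\times$ acts on the additive group $\mathbb F_q$ by multiplication. Let $s$ be any generator of $\mathbb F_q^\times\le\Gamma$ and let $t$ be any element of $\Gamma\setminus\mathbb F_q^\times$ with $t\ne t^{-1}$. Take the Cayley graph $\operatorname{Cay}(\Gamma,\{s,s^{-1},t,t^{-1}\})$, whose vertices are the elements of $\Gamma$ and whose edges are the pairs $\{g,gx\}$ with $g\in\Gamma$ and $x\in\{s,s^{-1},t,t^{-1}\}$, and replace each edge generated by $t$ or $t^{-1}$ by a path of $m=\lceil 2\log_2(q-1)\rceil-2$ edges with the same endpoints (and its own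 $m-1$ new inner vertices). The resulting graph has $n=q(q-1)m$ vertices, is connected, has maximum degree $4$, and its second eigenvalue multiplicity is at least $q-1$ and at least $\sqrt{n/\log_2 n}$. -/

import Mathlib

section Spectrum

/-- The maximum degree of a finite graph. -/
noncomputable def graphMaxDegree {V : Type*} [Fintype V] (G : SimpleGraph V) : ℕ := by
  classical exact G.maxDegree

/-- The eigenvalues `λ₁ ≥ λ₂ ≥ ⋯ ≥ λₙ` of the adjacency matrix of a finite graph, listed in
decreasing order and with multiplicity; the index `j : Fin n` stands for `λ_{j+1}`. -/
noncomputable def adjEigenvalue {V : Type*} [Fintype V] (G : SimpleGraph V) :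
    Fin (Fintype.card V) → ℝ := by
  classical exact (G.isHermitian_adjMatrix (R := ℝ)).eigenvalues₀

/-- The multiplicity of the second largest adjacency eigenvalue `λ₂`: the number of `j` with
`λ_j = λ₂`. (On a graph with fewer than two vertices there is no `λ₂`, and the value is `0`.) -/
noncomputable def secondEigenvalueMultiplicity {V : Type*} [Fintype V] (G : SimpleGraph V) : ℕ :=
  Nat.card {j : Fin (Fintype.card V) //
    ∃ h : 1 < Fintype.card V, adjEigenvalue G j = adjEigenvalue G ⟨1, h⟩}

end Spectrum

section Paths

/-- The `k`-th vertex (`0 ≤ k ≤ m`) of the `m`-edge path with index `i`, leading from `a i` to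
`b i` through the `m - 1` new vertices `(i, 0), …, (i, m - 2)`. -/
def pathVertex {V ι : Type*} (a b : ι → V) (m : ℕ) (i : ι) (k : ℕ) : V ⊕ ι × Fin (m - 1) :=
  if k = 0 then Sum.inl (a i)
  else if h : k - 1 < m - 1 then Sum.inr (i, ⟨k - 1, h⟩)
  else Sum.inl (b i)

/-- The graph obtained from `H` by replacing each of the edges `{a i, b i}` by a path of `m` edges
with the same endpoints: these edges are deleted from `H`, and for each `i` a new path of `m` edges
(with its own `m - 1` inner vertices) from `a i` to `b i` is put in. It is meant for `m ≥ 1` and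
for families in which each edge to be replaced occurs exactly once. -/
def replaceEdgesByPaths {V ι : Type*} (H : SimpleGraph V) (a b : ι → V) (m : ℕ) :
    SimpleGraph (V ⊕ ι × Fin (m - 1)) :=
  SimpleGraph.fromRel fun x y =>
    (∃ u v, (H.deleteEdges (Set.range fun i => s(a i, b i))).Adj u v ∧
      x = Sum.inl u ∧ y = Sum.inl v) ∨
    (∃ i, ∃ k < m, x = pathVertex a b m i k ∧ y = pathVertex a b m i (k + 1))

end Paths

section AffineGroup

/-- The action of `Fˣ` on the additive group of `F` by multiplication. -/
def unitsMulHom (F : Type*) [Field F] : Fˣ →* MulAut (Multiplicative F) where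
  toFun u := AddEquiv.toMultiplicative (DistribMulAction.toAddEquiv F u)
  map_one' := by
    ext x
    exact congrArg Multiplicative.ofAdd (one_smul Fˣ x.toAdd)
  map_mul' u v := by
    ext x
    exact congrArg Multiplicative.ofAdd (mul_smul u v x.toAdd)

/-- The semidirect product `Fˣ ⋉ F` for the action of `Fˣ` on `F` by multiplication, that is, the
affine group of `F`. Its complement `Fˣ` is the range of `SemidirectProduct.inr`. -/
abbrev AffGroup (F : Type*) [Field F] : Type _ :=
  Multiplicative F ⋊[unitsMulHom F] Fˣ

noncomputable instance AffGroup.instFintype (F : Type*) [Field F] [Fintype F] :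
    Fintype (AffGroup F) := by
  classical exact Fintype.ofEquiv (Multiplicative F × Fˣ) SemidirectProduct.equivProd.symm

/-- The graph obtained from the Cayley graph of `Fˣ ⋉ F` with generators `s, s⁻¹, t, t⁻¹`
(vertices `g`, edges `{g, g s}` and `{g, g t}`) by replacing each edge `{g, g t}` generated by `t`
or `t⁻¹` by a path of `m` edges. If `t ≠ t⁻¹`, then each of these edges is `{g, g t}` for exactly
one `g`, so the paths are indexed by `g`. -/
def affinePathGraph {F : Type*} [Field F] (s : Fˣ) (t : AffGroup F) (m : ℕ) :
    SimpleGraph (AffGroup F ⊕ AffGroup F × Fin (m - 1)) :=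
  replaceEdgesByPaths
    (SimpleGraph.mulCayley
      ({SemidirectProduct.inr s, (SemidirectProduct.inr s)⁻¹, t, t⁻¹} : Set (AffGroup F)))
    (fun g => g) (fun g => g * t) m

/-- The number `⌈2 log₂ (q - 1)⌉ - 2` of edges of each of the paths. -/
noncomputable def pathLength (q : ℕ) : ℕ := ⌈2 * Real.logb 2 ((q : ℝ) - 1)⌉₊ - 2

end AffineGroup

/-! The affine group `AffGroup F` acts on the graph by left multiplication and commutes with the
adjacency operator, so every eigenspace is a representation of it. A representation in which some
translation acts nontrivially has dimension at least $q-1$ (`card_units_le_finrank`). It therefore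
suffices to find an eigenvector for $\lambda_2$ that is not invariant under translations, and this
is done by separating two quadratic forms by a threshold $\mu$.

Translation-invariant functions restrict on the group vertices to functions on the cyclic group
$F^\times$. If such a function sums to zero over the group vertices, the Wirtinger inequality bounds
its $s$-edges by $\cos(2\pi/(q-1))$, the paths are bounded through a positive solution of the path
recurrence, and the form is at most $\mu\|f\|^2$
(`dotProduct_adjOperator_le_of_mem_translationInvariants`).

On the other side, a nonzero function $\varphi(g\cdot 0)$ of the image of the point $0$ does not
change along $s$-edges. Extended along each path by the solution of the recurrence for $\mu$, it has
form strictly above $\mu\|f\|^2$ (`lt_dotProduct_adjOperator_interpolant`). These functions contain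
a plane, so $\lambda_2>\mu$.

If eigenvectors for $\lambda_1$ and $\lambda_2$ were both translation-invariant, a combination of
them with zero sum would contradict the first bound (`le_secondEigenvalueMultiplicity`). The path
length $m$ is large enough, with $(q-1)^2\le 4\cdot 2^m$, for such a $\mu$ to exist
(`exists_pathProfile`), and small enough for $n\le (q-1)^2\log_2 n$ (`sqrt_card_div_logb_le`). -/

/-! ### Variational bounds for the second eigenvalue and its multiplicity. -/

section SpectralBounds

open Module

variable {V : Type*} [Fintype V]

open Classical in
/-- The adjacency operator `f ↦ (x ↦ ∑ y ∼ x, f y)` of a finite graph. -/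
noncomputable def adjOperator (G : SimpleGraph V) : (V → ℝ) →ₗ[ℝ] (V → ℝ) where
  toFun f x := ∑ y, if G.Adj x y then f y else 0
  map_add' f g := by
    ext x
    simp only [Pi.add_apply, ← Finset.sum_add_distrib]
    exact Finset.sum_congr rfl fun y _ => by split_ifs <;> simp
  map_smul' c f := by
    ext x
    simp only [Pi.smul_apply, smul_eq_mul, RingHom.id_apply, Finset.mul_sum]
    exact Finset.sum_congr rfl fun y _ => by split_ifs <;> simp

open Classical in
theorem adjOperator_eq_mulVec (G : SimpleGraph V) (f : V → ℝ) :
    adjOperator G f = (G.adjMatrix ℝ).mulVec f := by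
  ext x
  simp [adjOperator, Matrix.mulVec, dotProduct, SimpleGraph.adjMatrix_apply, ite_mul]

theorem adjEigenvalue_antitone (G : SimpleGraph V) : Antitone (adjEigenvalue G) := by
  classical
  unfold adjEigenvalue
  exact Matrix.IsHermitian.eigenvalues₀_antitone _

/-- An orthonormal eigenbasis of the adjacency operator, in coordinates. -/
theorem exists_adjOperator_eigenbasis (G : SimpleGraph V) :
    ∃ w : Fin (Fintype.card V) → V → ℝ,
      (∀ i, adjOperator G (w i) = adjEigenvalue G i • w i) ∧
      (∀ i j, w i ⬝ᵥ w j = if i = j then 1 else 0) ∧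
      ∀ f : V → ℝ, f = ∑ i, (w i ⬝ᵥ f) • w i := by
  classical
  let hA := G.isHermitian_adjMatrix (R := ℝ)
  let e : Fin (Fintype.card V) ≃ V := Fintype.equivOfCardEq (Fintype.card_fin _)
  have hdot (x y : EuclideanSpace ℝ V) : inner ℝ x y = (x : V → ℝ) ⬝ᵥ (y : V → ℝ) := by
    simp [PiLp.inner_apply, dotProduct, mul_comm]
  refine ⟨fun i => hA.eigenvectorBasis (e i), fun i => ?_, fun i j => ?_, fun f => ?_⟩
  · rw [adjOperator_eq_mulVec, hA.mulVec_eigenvectorBasis]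
    congr 1
    simp only [Matrix.IsHermitian.eigenvalues, adjEigenvalue]
    congr 1
    exact e.symm_apply_apply i
  · rw [← hdot, orthonormal_iff_ite.mp hA.eigenvectorBasis.orthonormal]
    simp
  · have h := hA.eigenvectorBasis.sum_repr' (WithLp.toLp 2 f)
    rw [← e.sum_comp] at h
    simp only [hdot] at h
    have h2 := congrArg (WithLp.ofLp) h
    simpa using h2.symm

theorem adjOperator_isSymm (G : SimpleGraph V) (f g : V → ℝ) :
    adjOperator G f ⬝ᵥ g = f ⬝ᵥ adjOperator G g := by
  classical
  rw [adjOperator_eq_mulVec, adjOperator_eq_mulVec, Matrix.dotProduct_mulVec,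
    ← Matrix.mulVec_transpose, SimpleGraph.transpose_adjMatrix]

/-- The dimension of an eigenspace is at most the number of indices of its eigenvalue. -/
theorem finrank_eigenspace_adjOperator_le (G : SimpleGraph V) (c : ℝ) :
    finrank ℝ (End.eigenspace (adjOperator G) c) ≤ Nat.card {i // adjEigenvalue G i = c} := by
  classical
  obtain ⟨w, hw, -, hexp⟩ := exists_adjOperator_eigenbasis G
  have hle : End.eigenspace (adjOperator G) c ≤
      Submodule.span ℝ (Set.range fun i : {i // adjEigenvalue G i = c} => w i) := by
    intro f hf
    rw [End.mem_eigenspace_iff] at hf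
    rw [hexp f]
    refine Submodule.sum_mem _ fun i _ => ?_
    by_cases hi : adjEigenvalue G i = c
    · exact Submodule.smul_mem _ _ (Submodule.subset_span ⟨⟨i, hi⟩, rfl⟩)
    · have h := adjOperator_isSymm G (w i) f
      rw [hw, hf, smul_dotProduct, dotProduct_smul, smul_eq_mul, smul_eq_mul] at h
      have : w i ⬝ᵥ f = 0 := by
        have : (adjEigenvalue G i - c) * (w i ⬝ᵥ f) = 0 := by linarith
        exact (mul_eq_zero.mp this).resolve_left (sub_ne_zero.mpr hi)
      simp [this]
  refine (Submodule.finrank_mono hle).trans ((finrank_range_le_card _).trans ?_)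
  rw [Nat.card_eq_fintype_card]

/-- Courant–Fischer for the second eigenvalue: a plane on which the quadratic form exceeds `μ`. -/
theorem lt_adjEigenvalue_one (G : SimpleGraph V) (hV : 1 < Fintype.card V) {μ : ℝ} (f g : V → ℝ)
    (hfg : ∀ a b : ℝ, (a ≠ 0 ∨ b ≠ 0) → μ * ((a • f + b • g) ⬝ᵥ (a • f + b • g)) <
      (a • f + b • g) ⬝ᵥ adjOperator G (a • f + b • g)) :
    μ < adjEigenvalue G ⟨1, hV⟩ := by
  classical
  obtain ⟨w, hw, hort, hexp⟩ := exists_adjOperator_eigenbasis G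
  let i₀ : Fin (Fintype.card V) := ⟨0, by omega⟩
  -- A plane meets the hyperplane orthogonal to the top eigenvector; on that hyperplane the form is
  -- at most $\lambda_2$ times the squared norm.
  obtain ⟨a, b, hab, h0⟩ : ∃ a b : ℝ, (a ≠ 0 ∨ b ≠ 0) ∧ w i₀ ⬝ᵥ (a • f + b • g) = 0 := by
    by_cases h : w i₀ ⬝ᵥ f = 0
    · exact ⟨1, 0, by simp, by simp [h]⟩
    · exact ⟨-(w i₀ ⬝ᵥ g), w i₀ ⬝ᵥ f, Or.inr h, by
        simp [dotProduct_add, dotProduct_smul]; ring⟩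
  have hlt := hfg a b hab
  generalize a • f + b • g = h at h0 hlt
  have hsq : h ⬝ᵥ h = ∑ i, (w i ⬝ᵥ h) ^ 2 := by
    conv_lhs => enter [1]; rw [hexp h]
    simp [sum_dotProduct, smul_dotProduct, sq]
  have hq : h ⬝ᵥ adjOperator G h = ∑ i, adjEigenvalue G i * (w i ⬝ᵥ h) ^ 2 := by
    conv_lhs => enter [1]; rw [hexp h]
    simp only [sum_dotProduct, smul_dotProduct, ← adjOperator_isSymm, hw, smul_eq_mul]
    exact Finset.sum_congr rfl fun i _ => by ring
  have hle : h ⬝ᵥ adjOperator G h ≤ adjEigenvalue G ⟨1, hV⟩ * (h ⬝ᵥ h) := by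
    rw [hq, hsq, Finset.mul_sum]
    refine Finset.sum_le_sum fun i _ => ?_
    by_cases hi : i = i₀
    · rw [hi, h0]; simp
    · refine mul_le_mul_of_nonneg_right (adjEigenvalue_antitone G ?_) (sq_nonneg _)
      rw [Fin.le_def]
      have : (i : ℕ) ≠ 0 := fun h => hi (Fin.ext h)
      simp only
      omega
  have hpos : 0 ≤ h ⬝ᵥ h := by rw [hsq]; positivity
  nlinarith

/-- A lower bound for the second eigenvalue multiplicity. Here `N` is a subspace such that every
eigenspace not contained in `N` has dimension at least `d`. -/
theorem le_secondEigenvalueMultiplicity (G : SimpleGraph V) (hV : 1 < Fintype.card V) {μ : ℝ}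
    {d : ℕ} (hd : 2 ≤ d) (f g : V → ℝ)
    (hfg : ∀ a b : ℝ, (a ≠ 0 ∨ b ≠ 0) → μ * ((a • f + b • g) ⬝ᵥ (a • f + b • g)) <
      (a • f + b • g) ⬝ᵥ adjOperator G (a • f + b • g))
    (N : Submodule ℝ (V → ℝ)) (L : (V → ℝ) →ₗ[ℝ] ℝ)
    (hN : ∀ h ∈ N, L h = 0 → h ⬝ᵥ adjOperator G h ≤ μ * (h ⬝ᵥ h))
    (hdim : ∀ c, ∀ h ∈ End.eigenspace (adjOperator G) c, h ∉ N →
      d ≤ finrank ℝ (End.eigenspace (adjOperator G) c)) :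
    d ≤ secondEigenvalueMultiplicity G := by
  classical
  have hlt := lt_adjEigenvalue_one G hV f g hfg
  obtain ⟨w, hw, hort, -⟩ := exists_adjOperator_eigenbasis G
  let i₀ : Fin (Fintype.card V) := ⟨0, by omega⟩
  let i₁ : Fin (Fintype.card V) := ⟨1, hV⟩
  have hanti := adjEigenvalue_antitone G
  have h01 : adjEigenvalue G i₁ ≤ adjEigenvalue G i₀ := hanti (by simp [i₀, i₁, Fin.le_def])
  have hmult : secondEigenvalueMultiplicity G =
      Nat.card {i // adjEigenvalue G i = adjEigenvalue G i₁} := by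
    unfold secondEigenvalueMultiplicity
    refine Nat.card_congr (Equiv.subtypeEquivRight fun i => ?_)
    exact ⟨fun ⟨_, h⟩ => h, fun h => ⟨hV, h⟩⟩
  rw [hmult]
  have key : ∀ i, w i ∉ N → d ≤ Nat.card {j // adjEigenvalue G j = adjEigenvalue G i} :=
    fun i hi => (hdim _ (w i) (End.mem_eigenspace_iff.mpr (hw i)) hi).trans
      (finrank_eigenspace_adjOperator_le G _)
  by_cases hw1 : w i₁ ∈ N
  swap
  · exact key _ hw1
  by_cases hw0 : w i₀ ∈ N
  swap
  · have h := key _ hw0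
    -- Here $\lambda_1$ itself has multiplicity at least $d\ge 2$, which forces
    -- $\lambda_2=\lambda_1$. This case distinction makes Perron–Frobenius unnecessary.
    suffices adjEigenvalue G i₁ = adjEigenvalue G i₀ by rwa [this]
    have h2 : 1 < Fintype.card {j // adjEigenvalue G j = adjEigenvalue G i₀} := by
      rw [← Nat.card_eq_fintype_card]; omega
    obtain ⟨⟨j, hj⟩, hne⟩ := Fintype.exists_ne_of_one_lt_card h2 ⟨i₀, rfl⟩
    refine le_antisymm h01 (hj ▸ hanti ?_)
    have : (j : ℕ) ≠ 0 := fun h => hne (Subtype.ext (Fin.ext h))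
    simp only [Fin.le_def, i₁]
    omega
  -- With both eigenvectors in `N`, some nonzero combination is killed by `L`, so its form is at
  -- most $\mu$ times its squared norm, although both eigenvalues exceed $\mu$.
  exfalso
  obtain ⟨a, b, hab, h0⟩ : ∃ a b : ℝ, (a ≠ 0 ∨ b ≠ 0) ∧ L (a • w i₀ + b • w i₁) = 0 := by
    by_cases h : L (w i₀) = 0
    · exact ⟨1, 0, by simp, by simp [h]⟩
    · exact ⟨-(L (w i₁)), L (w i₀), Or.inr h, by simp; ring⟩
  have h := hN _ (N.add_mem (N.smul_mem a hw0) (N.smul_mem b hw1)) h0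
  have e00 : w i₀ ⬝ᵥ w i₀ = 1 := by simp [hort]
  have e11 : w i₁ ⬝ᵥ w i₁ = 1 := by simp [hort]
  have e01 : w i₀ ⬝ᵥ w i₁ = 0 := by simp [hort, i₀, i₁]
  have e10 : w i₁ ⬝ᵥ w i₀ = 0 := by simp [hort, i₀, i₁]
  simp only [map_add, map_smul, hw, add_dotProduct, dotProduct_add, smul_dotProduct,
    dotProduct_smul, smul_eq_mul, e00, e11, e01, e10, mul_zero, mul_one, add_zero, zero_add] at h
  have ha := sq_nonneg a
  have hb := sq_nonneg b
  have hpos : 0 < a ^ 2 + b ^ 2 := by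
    rcases hab with h | h
    · have := pow_pos (abs_pos.mpr h) 2; rw [sq_abs] at this; linarith
    · have := pow_pos (abs_pos.mpr h) 2; rw [sq_abs] at this; linarith
  have hlt0 : μ < adjEigenvalue G i₀ := lt_of_lt_of_le hlt h01
  have hlt1 : μ < adjEigenvalue G i₁ := hlt
  nlinarith [mul_nonneg ha (sub_nonneg.mpr h01)]

end SpectralBounds

/-! ### Real representations of the affine group with nontrivial translations. -/

section AffineRepresentations

open Module

variable {F : Type*} [Field F]

/-- The translation `x ↦ x + a`, as an element of the affine group. -/
def AffGroup.translation (a : F) : AffGroup F := SemidirectProduct.inl (Multiplicative.ofAdd a)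

/-- The dilation `x ↦ u x`, as an element of the affine group. -/
def AffGroup.dilation (u : Fˣ) : AffGroup F := SemidirectProduct.inr u

namespace AffGroup

theorem left_mul (g h : AffGroup F) :
    (g * h).left.toAdd = g.left.toAdd + g.right * h.left.toAdd := rfl

theorem right_mul (g h : AffGroup F) : (g * h).right = g.right * h.right := rfl

theorem left_translation (a : F) : (translation a).left.toAdd = a := rfl

theorem right_translation (a : F) : (translation a).right = 1 := rfl

theorem left_dilation (u : Fˣ) : (dilation u).left.toAdd = 0 := rfl

theorem right_dilation (u : Fˣ) : (dilation u).right = u := rfl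

theorem ext_coords {g h : AffGroup F} (hl : g.left.toAdd = h.left.toAdd)
    (hr : g.right = h.right) : g = h :=
  SemidirectProduct.ext (Multiplicative.toAdd.injective hl) hr

theorem translation_mul (a b : F) :
    (translation a * translation b : AffGroup F) = translation (a + b) := by
  simp [translation, ← map_mul]

theorem translation_zero : (translation 0 : AffGroup F) = 1 := by
  simp [translation]

theorem dilation_mul_translation (u : Fˣ) (a : F) :
    (dilation u * translation a : AffGroup F) = translation (u * a) * dilation u := by
  refine ext_coords ?_ ?_
  · rw [left_mul, left_mul, left_dilation, left_translation, left_translation,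
      right_dilation]
    simp
  · rw [right_mul, right_mul, right_translation, right_translation, one_mul, mul_one]

theorem dilation_mul (u v : Fˣ) : (dilation u * dilation v : AffGroup F) = dilation (u * v) := by
  simp [dilation]

theorem dilation_one : (dilation 1 : AffGroup F) = 1 := by
  simp [dilation]

variable [Fintype F] {W : Type*} [AddCommGroup W] [Module ℝ W]

theorem sum_translation_translate (ρ : AffGroup F →* End ℝ W) (b : F) (f : W) :
    ρ (translation b) (∑ a, ρ (translation a) f) = ∑ a, ρ (translation a) f := by
  simp only [map_sum, ← Module.End.mul_apply, ← map_mul, translation_mul]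
  exact Fintype.sum_equiv (Equiv.addLeft b) _ _ fun _ => rfl

theorem sum_translation_apply (ρ : AffGroup F →* End ℝ W) (b : F) (f : W) :
    ∑ a, ρ (translation a) (ρ (translation b) f) = ∑ a, ρ (translation a) f := by
  simp only [← Module.End.mul_apply, ← map_mul, translation_mul]
  exact Fintype.sum_equiv (Equiv.addRight b) _ _ fun _ => rfl

theorem sum_translation_dilation (ρ : AffGroup F →* End ℝ W) (u : Fˣ) (f : W) :
    ∑ a, ρ (translation a) (ρ (dilation u) f) = ρ (dilation u) (∑ a, ρ (translation a) f) := by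
  simp only [map_sum, ← Module.End.mul_apply, ← map_mul, dilation_mul_translation]
  exact (Fintype.sum_equiv (Units.mulLeft u) _ _ fun _ => rfl).symm

open Classical in
theorem dilation_sum_dilation (ρ : AffGroup F →* End ℝ W) (u : Fˣ) (f : W) :
    ρ (dilation u) (∑ v, ρ (dilation v) f) = ∑ v, ρ (dilation v) f := by
  simp only [map_sum, ← Module.End.mul_apply, ← map_mul, dilation_mul]
  exact Fintype.sum_equiv (Equiv.mulLeft u) _ _ fun _ => rfl

open Classical in
/-- If the translations average a vector to zero, then the averages over the point stabilizers sum
up to a multiple of the vector. -/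
theorem sum_stabilizer_averages (ρ : AffGroup F →* End ℝ W) (g : W)
    (hg : ∑ a, ρ (translation a) g = 0) :
    ∑ b, ρ (translation (-b)) (∑ u, ρ (dilation u) (ρ (translation b) g)) =
      (Fintype.card F : ℝ) • g := by
  have h1 : ∀ (b : F) (u : Fˣ), ρ (translation (-b)) (ρ (dilation u) (ρ (translation b) g)) =
      ρ (translation ((u - 1 : F) * b)) (ρ (dilation u) g) := by
    intro b u
    simp only [← Module.End.mul_apply, ← map_mul]
    rw [dilation_mul_translation, ← mul_assoc, translation_mul]
    congr 4
    ring
  simp only [map_sum, h1]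
  -- For $u\ne 1$ the element $(u-1)b$ runs over all of $F$ as $b$ does, which gives a full
  -- translation average and hence zero. Only $u=1$ survives, contributing `g` once for each $b$.
  rw [Finset.sum_comm, Finset.sum_eq_single (1 : Fˣ)]
  · simp [dilation_one, translation_zero, Nat.cast_smul_eq_nsmul]
  · intro u _ hu
    have hu' : (u - 1 : F) ≠ 0 := by
      rw [sub_ne_zero]
      exact fun h => hu (Units.ext h)
    have h := Fintype.sum_equiv (Equiv.mulLeft₀ _ hu')
      (fun b => ρ (translation ((u - 1 : F) * b)) (ρ (dilation u) g))
      (fun a => ρ (translation a) (ρ (dilation u) g)) fun _ => rfl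
    rw [h, sum_translation_dilation, hg, map_zero]
  · simp

open Classical in
/-- The translates, other than itself, of a nonzero vector that is fixed by the dilations and
averaged to zero by the translations are linearly independent. -/
theorem linearIndependent_translates (ρ : AffGroup F →* End ℝ W) {φ : W} (hφ : φ ≠ 0)
    (hdil : ∀ u, ρ (dilation u) φ = φ) (hsum : ∑ a, ρ (translation a) φ = 0) :
    LinearIndependent ℝ fun u : Fˣ => ρ (translation (u : F)) φ := by
  rw [Fintype.linearIndependent_iff]
  intro c hc
  have hzero : ∑ u : Fˣ, ρ (translation (u : F)) φ = -φ := by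
    rw [Fintype.sum_eq_add_sum_subtype_ne _ (0 : F)] at hsum
    have h : ∑ u : Fˣ, ρ (translation (u : F)) φ =
        ∑ a : {a : F // a ≠ 0}, ρ (translation (a : F)) φ :=
      Fintype.sum_equiv unitsEquivNeZero _ _ fun _ => rfl
    rw [h]
    simp only [translation_zero, map_one, Module.End.one_apply] at hsum
    exact (neg_eq_of_add_eq_zero_right hsum).symm
  -- Since `φ` is fixed by dilations, dilating its translate by $a\ne 0$ yields each nonzero
  -- translate exactly once.
  have horbit : ∀ a : F, a ≠ 0 → ∑ v : Fˣ, ρ (dilation v) (ρ (translation a) φ) = -φ := by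
    intro a ha
    rw [← hzero]
    have : ∀ v : Fˣ, ρ (dilation v) (ρ (translation a) φ) =
        ρ (translation ((v * Units.mk0 a ha : Fˣ) : F)) φ := by
      intro v
      rw [← Module.End.mul_apply, ← map_mul, dilation_mul_translation, map_mul,
        Module.End.mul_apply, hdil]
      simp
    simp only [this]
    exact Fintype.sum_equiv (Equiv.mulRight (Units.mk0 a ha)) _ _ fun _ => rfl
  have hq : (Fintype.card Fˣ : ℝ) + 1 ≠ 0 := by positivity
  have h0 : -(∑ u, c u) = 0 := by
    have h := congrArg (fun x => ∑ v : Fˣ, ρ (dilation v) x) hc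
    simp only [map_sum, map_smul, map_zero, Finset.sum_const_zero] at h
    rw [Finset.sum_comm] at h
    simp only [← Finset.smul_sum, horbit _ (Units.ne_zero _), ← Finset.sum_smul] at h
    rw [smul_neg, ← neg_smul] at h
    exact (smul_eq_zero.mp h).resolve_right hφ
  -- Translating the relation by $-w$ moves the term of index $w$ to `φ` itself. Summing over
  -- dilations then gives $q\,c_w-\sum_u c_u=0$, and the last sum is already known to vanish.
  intro w
  have h := congrArg (fun x => ∑ v : Fˣ, ρ (dilation v) (ρ (translation (-w : F)) x)) hc
  simp only [map_sum, map_smul, map_zero, Finset.sum_const_zero] at h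
  rw [Finset.sum_comm] at h
  simp only [← Finset.smul_sum, ← Module.End.mul_apply (ρ (translation _)) (ρ (translation _)),
    ← map_mul, translation_mul] at h
  have hterm : ∀ u : Fˣ, c u • ∑ v : Fˣ, ρ (dilation v) (ρ (translation (-(w : F) + u)) φ) =
      (if u = w then c u * (Fintype.card Fˣ + 1) else 0) • φ - c u • φ := by
    intro u
    split_ifs with huw
    · subst huw
      simp only [neg_add_cancel, translation_zero, map_one, Module.End.one_apply, hdil,
        Finset.sum_const, Finset.card_univ, ← Nat.cast_smul_eq_nsmul ℝ]
      module
    · rw [horbit]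
      · module
      · intro h
        exact huw (Units.ext (by linear_combination h))
  simp only [hterm, Finset.sum_sub_distrib, ← Finset.sum_smul] at h
  rw [neg_eq_zero.mp h0] at h
  simpa [hφ, hq] using h

/-- An invariant subspace that contains a vector which is not fixed by the translations has
dimension at least `|F| - 1`. -/
theorem card_units_le_finrank [FiniteDimensional ℝ W] (ρ : AffGroup F →* End ℝ W)
    (E : Submodule ℝ W) (hE : ∀ g, ∀ f ∈ E, ρ g f ∈ E) {f : W} (hf : f ∈ E) {b : F}
    (hb : ρ (translation b) f ≠ f) :
    Fintype.card F - 1 ≤ finrank ℝ E := by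
  classical
  have hq : (Fintype.card F : ℝ) ≠ 0 := by
    have := Fintype.card_ne_zero (α := F)
    exact_mod_cast this
  -- Up to the factor $q$, this removes the translation-invariant part of `f`.
  let g : W := (Fintype.card F : ℝ) • f - ∑ a, ρ (translation a) f
  have hgE : g ∈ E := E.sub_mem (E.smul_mem _ hf) (E.sum_mem fun a _ => hE _ _ hf)
  have hg0 : g ≠ 0 := by
    intro h
    have h1 := sub_eq_zero.mp h
    have h2 := sum_translation_translate ρ b f
    rw [← h1, map_smul] at h2
    exact hb (smul_right_injective W hq h2)
  have hgsum : ∑ a, ρ (translation a) g = 0 := by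
    simp only [g, map_sub, map_smul, Finset.sum_sub_distrib, sum_translation_translate,
      ← Finset.smul_sum, Finset.sum_const, Finset.card_univ, ← Nat.cast_smul_eq_nsmul ℝ, sub_self]
  -- The averages over the stabilizers of the points of $F$ cannot all vanish, because their
  -- translates add up to $q\,g\ne 0$. A nonzero one supplies a dilation-fixed vector.
  obtain ⟨c, hc⟩ : ∃ c : F, ∑ u, ρ (dilation u) (ρ (translation c) g) ≠ 0 := by
    by_contra! h
    have h2 := sum_stabilizer_averages ρ g hgsum
    simp only [h, map_zero, Finset.sum_const_zero] at h2
    exact (smul_ne_zero hq hg0) h2.symm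
  set φ := ∑ u, ρ (dilation u) (ρ (translation c) g) with hφ
  have hφE : φ ∈ E := E.sum_mem fun u _ => hE _ _ (hE _ _ hgE)
  have hφsum : ∑ a, ρ (translation a) φ = 0 := by
    simp only [hφ, map_sum]
    rw [Finset.sum_comm]
    simp only [sum_translation_dilation, sum_translation_apply, hgsum, map_zero,
      Finset.sum_const_zero]
  have hli := linearIndependent_translates ρ hc (fun u => dilation_sum_dilation ρ u _) hφsum
  have hli' : LinearIndependent ℝ fun u : Fˣ => (⟨ρ (translation (u : F)) φ, hE _ _ hφE⟩ : E) := by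
    refine LinearIndependent.of_comp E.subtype ?_
    exact hli
  have h := hli'.fintype_card_le_finrank
  rwa [Fintype.card_units] at h

end AffGroup

end AffineRepresentations

/-! ### A discrete Wirtinger inequality by Fourier analysis on a cyclic group. -/

section CyclicWirtinger

open Complex Real

theorem cos_two_pi_mul_div_le {k j : ℕ} (hj : 1 ≤ j) (hjk : j + 1 ≤ k) :
    Real.cos (2 * π * j / k) ≤ Real.cos (2 * π / k) := by
  have hk : (0 : ℝ) < k := by exact_mod_cast (by omega : 0 < k)
  have hj' : (1 : ℝ) ≤ j := by exact_mod_cast hj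
  have hjk' : (j : ℝ) + 1 ≤ k := by exact_mod_cast hjk
  have hpi := Real.pi_pos
  rcases le_total (2 * j) k with h | h
  · have h' : 2 * (j : ℝ) ≤ k := by exact_mod_cast h
    refine Real.cos_le_cos_of_nonneg_of_le_pi (by positivity) ?_ ?_
    · rw [div_le_iff₀ hk]; nlinarith
    · exact div_le_div_of_nonneg_right (by nlinarith) hk.le
  · have h' : (k : ℝ) ≤ 2 * j := by exact_mod_cast h
    rw [← Real.cos_two_pi_sub (2 * π * j / k)]
    have e : 2 * π - 2 * π * j / k = 2 * π * (k - j) / k := by field_simp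
    rw [e]
    refine Real.cos_le_cos_of_nonneg_of_le_pi (by positivity) ?_ ?_
    · rw [div_le_iff₀ hk]; nlinarith
    · exact div_le_div_of_nonneg_right (by nlinarith) hk.le

theorem re_stdAddChar_le {k : ℕ} [NeZero k] {ξ : ZMod k} (hξ : ξ ≠ 0) :
    (ZMod.stdAddChar ξ).re ≤ Real.cos (2 * π / k) := by
  have h1 : (ZMod.stdAddChar ξ).re = Real.cos (2 * π * (ξ.val : ℕ) / k) := by
    have h := ZMod.stdAddChar_coe (N := k) (ξ.val : ℤ)
    rw [Int.cast_natCast, ZMod.natCast_val, ZMod.cast_id] at h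
    rw [h, Complex.exp_re]
    have e : (2 * π * I * ((ξ.val : ℤ) : ℂ) / (k : ℂ)) = ((2 * π * ξ.val / k : ℝ) : ℂ) * I := by
      push_cast
      ring
    rw [e]
    simp
  rw [h1]
  refine cos_two_pi_mul_div_le ?_ ?_
  · exact Nat.one_le_iff_ne_zero.mpr ((ZMod.val_ne_zero ξ).mpr hξ)
  · exact ZMod.val_lt ξ

/-- The discrete Wirtinger inequality on a cycle. -/
theorem sum_mul_shift_le_zmod {k : ℕ} [NeZero k] (h : ZMod k → ℝ) (hsum : ∑ x, h x = 0) :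
    ∑ x, h x * h (x + 1) ≤ Real.cos (2 * π / k) * ∑ x, h x ^ 2 := by
  -- Parseval for the autocorrelation: $d=1$ gives the shifted sum and $d=0$ the sum of squares,
  -- with the same weights $|\hat h(\xi)|^2$. The inequality can then be compared frequency by
  -- frequency.
  have hshift : ∀ d : ZMod k, ∑ ξ, (ZMod.stdAddChar (ξ * d)) *
      (starRingEnd ℂ (∑ x, (h x : ℂ) * ZMod.stdAddChar (ξ * x)) *
        (∑ x, (h x : ℂ) * ZMod.stdAddChar (ξ * x))) = k * ∑ x, (h (x + d) : ℂ) * h x := by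
    intro d
    have e : ∀ ξ : ZMod k, (ZMod.stdAddChar (ξ * d)) *
      (starRingEnd ℂ (∑ x, (h x : ℂ) * ZMod.stdAddChar (ξ * x)) *
        (∑ x, (h x : ℂ) * ZMod.stdAddChar (ξ * x))) =
        ∑ y, ∑ x, (h y : ℂ) * h x * ZMod.stdAddChar (ξ * (x + d - y)) := by
      intro ξ
      rw [map_sum, Finset.sum_mul_sum, Finset.mul_sum]
      refine Finset.sum_congr rfl fun y _ => ?_
      rw [Finset.mul_sum]
      refine Finset.sum_congr rfl fun x _ => ?_
      have hconj : starRingEnd ℂ (ZMod.stdAddChar (ξ * y)) = ZMod.stdAddChar (-(ξ * y)) := by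
        rw [AddChar.map_neg_eq_conj]
      rw [map_mul (starRingEnd ℂ), hconj, conj_ofReal, mul_sub, mul_add, sub_eq_add_neg, AddChar.map_add_eq_mul,
        AddChar.map_add_eq_mul]
      ring
    simp only [e]
    rw [Finset.sum_comm]
    have e2 : ∀ y : ZMod k, ∑ ξ, ∑ x, (h y : ℂ) * h x * ZMod.stdAddChar (ξ * (x + d - y)) =
        ∑ x, if y = x + d then (k : ℂ) * (h y * h x) else 0 := by
      intro y
      rw [Finset.sum_comm]
      refine Finset.sum_congr rfl fun x _ => ?_
      rw [← Finset.mul_sum, AddChar.sum_mulShift _ (ZMod.isPrimitive_stdAddChar k)]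
      by_cases hy : y = x + d
      · simp [hy]; ring
      · have : x + d - y ≠ 0 := fun h => hy (sub_eq_zero.mp h).symm
        simp [hy, this]
    simp only [e2]
    rw [Finset.sum_comm]
    simp [Finset.mul_sum]
  have h1 := congrArg Complex.re (hshift 1)
  have h0 := congrArg Complex.re (hshift 0)
  simp only [mul_one, mul_zero, AddChar.map_zero_eq_one, one_mul, add_zero, ← normSq_eq_conj_mul_self,
    ← ofReal_mul, ← ofReal_sum, re_sum, ← ofReal_natCast, ofReal_re, re_mul_ofReal] at h0 h1
  have hk : (0 : ℝ) < k := by exact_mod_cast Nat.pos_of_ne_zero (NeZero.ne k)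
  have hle : (k : ℝ) * ∑ x, h (x + 1) * h x ≤ k * (Real.cos (2 * π / k) * ∑ x, h x * h x) := by
    rw [mul_left_comm, ← h0, ← h1, Finset.mul_sum]
    refine Finset.sum_le_sum fun ξ _ => ?_
    by_cases hξ : ξ = 0
    -- The zero frequency, where the multiplier is $1$, is absent because `h` has sum zero.
    · have : ∑ x, (h x : ℂ) * ZMod.stdAddChar (ξ * x) = 0 := by
        simp [hξ, ← ofReal_sum, hsum]
      simp [this]
    · exact mul_le_mul_of_nonneg_right (re_stdAddChar_le hξ) (normSq_nonneg _)
  have := le_of_mul_le_mul_left hle hk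
  simpa only [mul_comm (h _) (h (_ + 1)), sq] using this

/-- The discrete Wirtinger inequality on a finite cyclic group with generator `s`. -/
theorem sum_mul_shift_le_of_zpowers_eq_top {C : Type*} [Group C] [Fintype C] (s : C)
    (hs : Subgroup.zpowers s = ⊤) (h : C → ℝ) (hsum : ∑ x, h x = 0) :
    ∑ x, h x * h (x * s) ≤ Real.cos (2 * π / Fintype.card C) * ∑ x, h x ^ 2 := by
  classical
  have hcard : Nat.card (Subgroup.zpowers s) = Fintype.card C := by
    rw [hs, Nat.card_congr Subgroup.topEquiv.toEquiv, Nat.card_eq_fintype_card]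
  have : NeZero (Fintype.card C) := ⟨Fintype.card_ne_zero⟩
  obtain ⟨e, he⟩ : ∃ e : ZMod (Fintype.card C) ≃ C, ∀ x, e (x + 1) = e x * s := by
    have hord : orderOf s = Fintype.card C := by rw [← Nat.card_zpowers, hcard]
    let f : ZMod (Fintype.card C) → C := fun x => s ^ x.val
    have hf : Function.Surjective f := by
      intro y
      have hy : y ∈ Subgroup.zpowers s := by rw [hs]; trivial
      obtain ⟨n, -, rfl⟩ := Finset.mem_image.mp (mem_zpowers_iff_mem_range_orderOf.mp hy)
      refine ⟨n, ?_⟩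
      simp only [f, ZMod.val_natCast, ← hord, pow_mod_orderOf]
    refine ⟨Equiv.ofBijective f ((Fintype.bijective_iff_surjective_and_card f).mpr
      ⟨hf, by rw [ZMod.card]⟩), fun x => ?_⟩
    simp only [Equiv.ofBijective_apply, f]
    rw [← pow_succ, pow_inj_mod, hord, ← ZMod.natCast_eq_natCast_iff']
    simp
  have := sum_mul_shift_le_zmod (fun x => h (e x)) (by rw [e.sum_comp]; exact hsum)
  simp only [he] at this
  rwa [e.sum_comp (fun x => h x * h (x * s)), e.sum_comp (fun x => h x ^ 2)] at this

end CyclicWirtinger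

/-! ### Quadratic forms on paths, and the choice of the threshold. -/

section PathForms

/-- Solutions `p` and `r` of the eigenvalue equation `f (k - 1) + f (k + 1) = μ f k` in the interior
of a path with `m` edges: `p` is positive with boundary values `1, 1` and neighbouring values
`P, P`, and `r` has boundary values `1, -1` and neighbouring values `R, -R`. -/
structure PathProfile (m : ℕ) (μ P R : ℝ) where
  p : ℕ → ℝ
  r : ℕ → ℝ
  p_pos : ∀ k, 0 < p k
  p_zero : p 0 = 1
  p_last : p m = 1
  r_zero : r 0 = 1
  r_last : r m = -1
  p_rec : ∀ k, k + 2 ≤ m → p k + p (k + 2) = μ * p (k + 1)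
  r_rec : ∀ k, k + 2 ≤ m → r k + r (k + 2) = μ * r (k + 1)
  p_one : p 1 = P
  p_pred : p (m - 1) = P
  r_one : r 1 = R
  r_pred : r (m - 1) = -R

namespace PathProfile

variable {m : ℕ} {μ P R : ℝ}

/-- The quadratic form of a path is at most `P` times the sum of the squares of the boundary
values. -/
theorem sum_mul_succ_le (h : PathProfile m μ P R) (hm : 1 ≤ m) (f : ℕ → ℝ) :
    2 * ∑ k ∈ Finset.range m, f k * f (k + 1) ≤
      μ * ∑ k ∈ Finset.range (m - 1), f (k + 1) ^ 2 + P * (f 0 ^ 2 + f m ^ 2) := by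
  obtain ⟨M, rfl⟩ : ∃ M, m = M + 1 := ⟨m - 1, by omega⟩
  -- AM–GM weighted by the positive solution `p`. After summation an inner vertex gets the
  -- coefficient $(p_{k-1}+p_{k+1})/p_k=\mu$, and each end gets $P$.
  have hle : ∀ k, 2 * (f k * f (k + 1)) ≤
      h.p (k + 1) / h.p k * f k ^ 2 + h.p k / h.p (k + 1) * f (k + 1) ^ 2 := by
    intro k
    have h0 := h.p_pos k
    have h1 := h.p_pos (k + 1)
    have e : h.p (k + 1) / h.p k * f k ^ 2 + h.p k / h.p (k + 1) * f (k + 1) ^ 2 -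
        2 * (f k * f (k + 1)) =
        (h.p (k + 1) * f k - h.p k * f (k + 1)) ^ 2 / (h.p k * h.p (k + 1)) := by
      field_simp
      ring
    have : 0 ≤ (h.p (k + 1) * f k - h.p k * f (k + 1)) ^ 2 / (h.p k * h.p (k + 1)) := by positivity
    linarith
  have e1 : P = h.p (0 + 1) / h.p 0 := by rw [h.p_zero, zero_add, h.p_one, div_one]
  have e2 : P = h.p M / h.p (M + 1) := by
    rw [h.p_last, div_one]
    exact h.p_pred.symm
  calc 2 * ∑ k ∈ Finset.range (M + 1), f k * f (k + 1)
      ≤ ∑ k ∈ Finset.range (M + 1),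
        (h.p (k + 1) / h.p k * f k ^ 2 + h.p k / h.p (k + 1) * f (k + 1) ^ 2) := by
        rw [Finset.mul_sum]
        exact Finset.sum_le_sum fun k _ => hle k
    _ = ∑ k ∈ Finset.range M, (h.p (k + 2) / h.p (k + 1) * f (k + 1) ^ 2 +
          h.p k / h.p (k + 1) * f (k + 1) ^ 2) + P * (f 0 ^ 2 + f (M + 1) ^ 2) := by
        rw [Finset.sum_add_distrib, Finset.sum_range_succ', Finset.sum_range_succ _ M, ← e1, ← e2,
          Finset.sum_add_distrib]
        ring
    _ = _ := by
        rw [Nat.add_sub_cancel, Finset.mul_sum]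
        congr 1
        refine Finset.sum_congr rfl fun k hk => ?_
        have hk' := Finset.mem_range.mp hk
        have h1 := h.p_pos (k + 1)
        have h2 := h.p_rec k (by omega)
        field_simp
        linear_combination f (k + 1) ^ 2 * h2

/-- The solution of the eigenvalue equation with boundary values `x` and `y`. -/
noncomputable def interp (h : PathProfile m μ P R) (x y : ℝ) (k : ℕ) : ℝ :=
  (x + y) / 2 * h.p k + (x - y) / 2 * h.r k

theorem interp_zero (h : PathProfile m μ P R) (x y : ℝ) : h.interp x y 0 = x := by
  rw [interp, h.p_zero, h.r_zero]
  ring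

theorem interp_last (h : PathProfile m μ P R) (x y : ℝ) : h.interp x y m = y := by
  rw [interp, h.p_last, h.r_last]
  ring

theorem interp_smul_add (h : PathProfile m μ P R) (a b x y x' y' : ℝ) (k : ℕ) :
    h.interp (a * x + b * x') (a * y + b * y') k = a * h.interp x y k + b * h.interp x' y' k := by
  simp only [interp]
  ring

/-- Multiplying the recurrence by the value at the middle vertex and summing counts every product of
neighbours twice, except the two at the ends. Those are the boundary terms, and they split into the
even part with $P$ and the odd part with $R$. -/
theorem sum_interp_mul_succ (h : PathProfile m μ P R) (hm : 1 ≤ m) (x y : ℝ) :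
    2 * ∑ k ∈ Finset.range m, h.interp x y k * h.interp x y (k + 1) =
      μ * ∑ k ∈ Finset.range (m - 1), h.interp x y (k + 1) ^ 2 +
        (R * (x ^ 2 + y ^ 2) + (P - R) / 2 * (x + y) ^ 2) := by
  have hbd : x * h.interp x y 1 + h.interp x y (m - 1) * y =
      R * (x ^ 2 + y ^ 2) + (P - R) / 2 * (x + y) ^ 2 := by
    simp only [interp, h.p_one, h.r_one, h.p_pred, h.r_pred]
    ring
  have hrec : ∀ k, k + 2 ≤ m →
      h.interp x y k + h.interp x y (k + 2) = μ * h.interp x y (k + 1) := by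
    intro k hk
    simp only [interp]
    linear_combination (x + y) / 2 * h.p_rec k hk + (x - y) / 2 * h.r_rec k hk
  rw [← hbd]
  have hl := h.interp_last x y
  have h0 := h.interp_zero x y
  generalize h.interp x y = f at *
  obtain ⟨M, rfl⟩ : ∃ M, m = M + 1 := ⟨m - 1, by omega⟩
  have hsum : ∑ k ∈ Finset.range M, (f k * f (k + 1) + f (k + 1) * f (k + 2)) =
      μ * ∑ k ∈ Finset.range M, f (k + 1) ^ 2 := by
    rw [Finset.mul_sum]
    refine Finset.sum_congr rfl fun k hk => ?_
    have hk' := Finset.mem_range.mp hk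
    linear_combination f (k + 1) * hrec k (by omega)
  rw [Nat.add_sub_cancel, ← hsum, two_mul, Finset.sum_add_distrib]
  nth_rewrite 1 [Finset.sum_range_succ]
  rw [Finset.sum_range_succ', h0, hl]
  ring

/-- The profile with `μ = 2` on a path with two edges. -/
noncomputable def two : PathProfile 2 2 1 0 where
  p _ := 1
  r k := 1 - k
  p_pos _ := one_pos
  p_zero := rfl
  p_last := rfl
  r_zero := by simp
  r_last := by norm_num
  p_rec _ _ := by norm_num
  r_rec k _ := by push_cast; ring
  p_one := rfl
  p_pred := rfl
  r_one := by norm_num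
  r_pred := by norm_num

/-- The profile with `μ = β + β⁻¹` for `β > 1`. -/
noncomputable def exponential (m : ℕ) (hm : 2 ≤ m) (β : ℝ) (hβ : 1 < β) :
    PathProfile m (β + β⁻¹) ((β + β ^ (m - 1)) / (1 + β ^ m))
      ((β ^ (m - 1) - β) / (β ^ m - 1)) where
  -- The factor $\beta^m\beta^{-k}$ stands for $\beta^{m-k}$ without truncated subtraction, so the
  -- formulas also make sense for $k>m$.
  p k := (β ^ k + β ^ (m : ℤ) * β⁻¹ ^ k) / (1 + β ^ m)
  r k := (β ^ (m : ℤ) * β⁻¹ ^ k - β ^ k) / (β ^ m - 1)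
  p_pos k := by
    have : 0 < β := by linarith
    positivity
  p_zero := by
    have : 0 < 1 + β ^ m := by positivity
    simp [this.ne']
  p_last := by
    have h : 0 < β := by linarith
    have : 0 < 1 + β ^ m := by positivity
    rw [inv_pow, zpow_natCast]
    field_simp
    ring
  r_zero := by
    have : 1 < β ^ m := one_lt_pow₀ hβ (by omega)
    simp [(sub_pos.mpr this).ne']
  r_last := by
    have h : 0 < β := by linarith
    have : 0 < β ^ m - 1 := sub_pos.mpr (one_lt_pow₀ hβ (by omega))
    rw [inv_pow, zpow_natCast]
    field_simp
    ring
  p_rec k _ := by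
    have h : 0 < β := by linarith
    rw [mul_div_assoc', ← add_div]
    congr 1
    simp only [pow_succ]
    field_simp
    ring
  r_rec k _ := by
    have h : 0 < β := by linarith
    rw [mul_div_assoc', ← add_div]
    congr 1
    simp only [pow_succ]
    field_simp
    ring
  p_one := by
    have h : 0 < β := by linarith
    rw [zpow_natCast, pow_one, pow_one, ← pow_sub_one_mul (by omega : m ≠ 0)]
    field_simp
  p_pred := by
    have h : 0 < β := by linarith
    rw [inv_pow, zpow_natCast, ← pow_sub_one_mul (by omega : m ≠ 0)]
    field_simp
    ring
  r_one := by
    have h : 0 < β := by linarith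
    rw [zpow_natCast, pow_one, pow_one, ← pow_sub_one_mul (by omega : m ≠ 0)]
    field_simp
  r_pred := by
    have h : 0 < β := by linarith
    rw [inv_pow, zpow_natCast, ← pow_sub_one_mul (by omega : m ≠ 0)]
    field_simp
    ring

end PathProfile

/-! ### Numerical estimates for the path length. -/

section PathLength

open Real

theorem pathLength_add_two {q : ℕ} (hq : 4 ≤ q) :
    2 ≤ pathLength q ∧ (2 * logb 2 ((q : ℝ) - 1) ≤ pathLength q + 2) ∧
      (pathLength q : ℝ) + 1 < 2 * logb 2 ((q : ℝ) - 1) := by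
  have hq' : (4 : ℝ) ≤ q := by exact_mod_cast hq
  set x := 2 * logb 2 ((q : ℝ) - 1) with hx
  -- From $(q-1)^2\ge 9>2^3$. The ceiling is thus at least $4$, and the natural subtraction in
  -- `pathLength` does not truncate.
  have hx3 : 3 < x := by
    have h : x = logb 2 (((q : ℝ) - 1) ^ 2) := by rw [hx, logb_pow]; norm_num
    rw [h, lt_logb_iff_rpow_lt (by norm_num) (by nlinarith)]
    norm_num
    nlinarith
  have hceil : 3 < ⌈x⌉₊ := by
    rw [Nat.lt_ceil]
    exact_mod_cast hx3
  have e : (pathLength q : ℝ) + 2 = ⌈x⌉₊ := by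
    have : pathLength q + 2 = ⌈x⌉₊ := by
      change ⌈x⌉₊ - 2 + 2 = ⌈x⌉₊
      omega
    exact_mod_cast this
  refine ⟨?_, ?_, ?_⟩
  · change 2 ≤ ⌈x⌉₊ - 2
    omega
  · rw [e]
    exact Nat.le_ceil x
  · have := Nat.ceil_lt_add_one (by linarith : 0 ≤ x)
    linarith

theorem sq_le_two_pow_pathLength {q : ℕ} (hq : 4 ≤ q) :
    ((q : ℝ) - 1) ^ 2 ≤ 4 * 2 ^ pathLength q := by
  have hq' : (4 : ℝ) ≤ q := by exact_mod_cast hq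
  have h := (pathLength_add_two hq).2.1
  have e : 2 * logb 2 ((q : ℝ) - 1) = logb 2 (((q : ℝ) - 1) ^ 2) := by rw [logb_pow]; norm_num
  rw [e, logb_le_iff_le_rpow (by norm_num) (by nlinarith)] at h
  have e2 : (2 : ℝ) ^ ((pathLength q : ℝ) + 2) = 4 * 2 ^ pathLength q := by
    rw [rpow_add (by norm_num), rpow_natCast]
    norm_num
    ring
  rwa [e2] at h

/-- The path length is so chosen that `q (q - 1) m ≤ (q - 1) ^ 2 log₂ (q (q - 1) m)`. -/
theorem sqrt_card_div_logb_le {q : ℕ} (hq : 4 ≤ q) :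
    √(((q * (q - 1) * pathLength q : ℕ) : ℝ) /
      logb 2 ((q * (q - 1) * pathLength q : ℕ) : ℝ)) ≤ (q : ℝ) - 1 := by
  have hq' : (4 : ℝ) ≤ q := by exact_mod_cast hq
  obtain ⟨h2, -, hlt⟩ := pathLength_add_two hq
  generalize pathLength q = m at h2 hlt
  have h2' : (2 : ℝ) ≤ m := by exact_mod_cast h2
  have ecast : ((q * (q - 1) * m : ℕ) : ℝ) = q * (q - 1) * m := by
    push_cast [Nat.cast_sub (by omega : 1 ≤ q)]
    ring
  rw [ecast]
  set k : ℝ := (q : ℝ) - 1 with hk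
  have hqk : (q : ℝ) = k + 1 := by rw [hk]; ring
  have hk3 : 3 ≤ k := by linarith
  have hlogk : logb 2 k ≤ k := by
    rw [logb_le_iff_le_rpow (by norm_num) (by linarith)]
    have h1 := one_add_mul_self_le_rpow_one_add (by norm_num : (-1 : ℝ) ≤ 1) (by linarith : 1 ≤ k)
    norm_num at h1
    linarith
  have hlogm : 1 ≤ logb 2 (m : ℝ) := by
    rw [le_logb_iff_rpow_le (by norm_num) (by linarith)]
    simpa using h2'
  have hlog : 2 * logb 2 k + 1 ≤ logb 2 ((q : ℝ) * k * m) := by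
    rw [logb_mul (by positivity) (by positivity), logb_mul (by positivity) (by positivity)]
    have : logb 2 k ≤ logb 2 (q : ℝ) :=
      logb_le_logb_of_le (by norm_num) (by linarith) (by linarith)
    linarith
  have hpos : 0 < logb 2 ((q : ℝ) * k * m) := by linarith
  rw [sqrt_le_left (by linarith), div_le_iff₀ hpos]
  -- With $L=\log_2 k$ and $m<2L-1$, this reduces to $2L\le 2k+1$, which follows from $L\le k$.
  have h1 : (m : ℝ) * (k + 1) ≤ k * (2 * logb 2 k + 1) := by nlinarith
  calc (q : ℝ) * k * m = k * (m * (k + 1)) := by rw [hqk]; ring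
    _ ≤ k * (k * (2 * logb 2 k + 1)) := by gcongr
    _ ≤ k * (k * logb 2 ((q : ℝ) * k * m)) := by gcongr
    _ = _ := by ring

theorem cos_two_pi_div_le {k : ℝ} (hk : 5 ≤ k) : cos (2 * π / k) ≤ 1 - 16 / k ^ 2 := by
  have hk0 : 0 < k := by linarith
  have hpi := pi_gt_d4
  have hpi' := pi_lt_d4
  set x := π / k with hx
  have hx0 : 0 < x := by positivity
  have hxk : x * k = π := by rw [hx]; field_simp
  have hx5 : x ≤ 0.62832 := by
    rw [hx, div_le_iff₀ hk0]
    linarith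
  -- The constant is $1-0.3948/4$; what matters is that $(0.9013\,\pi)^2\ge 8$.
  have hsin : 0.9013 * x ≤ sin x := by
    have h := sin_gt_sub_cube hx0
    have : x ^ 2 ≤ 0.3948 := by nlinarith
    nlinarith
  have e : 2 * π / k = 2 * x := by rw [hx]; ring
  rw [e, cos_two_mul, cos_sq']
  have hk8 : 8 / k ^ 2 ≤ sin x ^ 2 := by
    have h1 : (0.9013 * x) ^ 2 ≤ sin x ^ 2 := by gcongr
    refine le_trans ?_ h1
    rw [div_le_iff₀ (by positivity)]
    have : (0.9013 * x) ^ 2 * k ^ 2 = (0.9013 * π) ^ 2 := by rw [← hxk]; ring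
    rw [this]
    nlinarith
  have e3 : 16 / k ^ 2 = 2 * (8 / k ^ 2) := by ring
  rw [e3]
  linarith

/-- A profile for the paths of `pathLength q` edges that separates the second largest eigenvalue
from those of the nontrivial linear characters. -/
theorem exists_pathProfile {q : ℕ} (hq : 4 ≤ q) :
    ∃ μ P R : ℝ, Nonempty (PathProfile (pathLength q) μ P R) ∧ 0 ≤ 2 - μ + 2 * R ∧ R < P ∧
      2 * cos (2 * π / ((q : ℝ) - 1)) - μ + 2 * P ≤ 0 := by
  have hq' : (4 : ℝ) ≤ q := by exact_mod_cast hq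
  obtain ⟨h2, hge, hlt⟩ := pathLength_add_two hq
  have hsq := sq_le_two_pow_pathLength hq
  have hpi := pi_pos
  -- For $q\le 5$ the paths have two edges and the general choice would give $\beta<2$. There
  -- $\mu=2$ works, since $\cos(2\pi/(q-1))\le 0$.
  by_cases h5 : q ≤ 5
  · have h5' : (q : ℝ) ≤ 5 := by exact_mod_cast h5
    have hm : pathLength q = 2 := by
      have : logb 2 ((q : ℝ) - 1) ≤ 2 := by
        rw [logb_le_iff_le_rpow (by norm_num) (by linarith)]
        norm_num
        linarith
      have h3 : (pathLength q : ℝ) < 3 := by linarith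
      have : pathLength q < 3 := by exact_mod_cast h3
      omega
    rw [hm]
    refine ⟨2, 1, 0, ⟨PathProfile.two⟩, by norm_num, by norm_num, ?_⟩
    have : cos (2 * π / ((q : ℝ) - 1)) ≤ 0 := by
      refine cos_nonpos_of_pi_div_two_le_of_le ?_ ?_
      · rw [div_le_div_iff₀ (by norm_num) (by linarith)]
        nlinarith
      · rw [div_le_iff₀ (by linarith)]
        nlinarith
    linarith
  · have h6 : (5 : ℝ) ≤ (q : ℝ) - 1 := by
      have : (6 : ℝ) ≤ q := by exact_mod_cast (by omega : 6 ≤ q)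
      linarith
    have hcos := cos_two_pi_div_le h6
    generalize hmm : pathLength q = m at *
    set k := (q : ℝ) - 1
    have hm3 : 3 ≤ m := by
      by_contra hcon
      have hm2 : m = 2 := by omega
      rw [hm2] at hsq
      nlinarith
    set X : ℝ := 2 ^ m with hX
    have hX8 : 8 ≤ X := by
      calc (8 : ℝ) = 2 ^ 3 := by norm_num
        _ ≤ 2 ^ m := pow_le_pow_right₀ (by norm_num) hm3
    -- With $\beta-\beta^{-1}=2\tau$ and $T=(\beta^m-1)/(\beta^m+1)$ one has $2P-\mu=-2\tau T$ and
    -- $2R-\mu=-2\tau/T$. The requirements become $\tau\le T<1$ and $\cos(2\pi/k)\le\tau T$. The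
    -- first holds because $\beta\ge 2$ makes $\beta^m\ge X$; the second because $1-\tau^2\le 4/X\le
    -- 16/k^2$.
    set τ : ℝ := (X - 1) / (X + 1) with hτ
    have hτ34 : 3 / 4 ≤ τ := by
      rw [hτ, div_le_div_iff₀ (by norm_num) (by linarith)]
      linarith
    set β : ℝ := τ + √(1 + τ ^ 2) with hβ
    have hsqrt : √(1 + τ ^ 2) ^ 2 = 1 + τ ^ 2 := sq_sqrt (by positivity)
    have hβ2 : 2 ≤ β := by
      have : 5 / 4 ≤ √(1 + τ ^ 2) := le_sqrt_of_sq_le (by nlinarith)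
      linarith
    have hβτ : β - β⁻¹ = 2 * τ := by
      have h1 : β * β - 1 = 2 * τ * β := by
        rw [hβ]
        linear_combination hsqrt
      field_simp
      linear_combination h1
    have hβX : X ≤ β ^ m := by
      rw [hX]
      gcongr
    set Y := β ^ m with hY
    set T := (Y - 1) / (Y + 1) with hT
    have hτT : τ ≤ T := by
      rw [hτ, hT, div_le_div_iff₀ (by linarith) (by linarith)]
      linarith
    have hpred : β ^ (m - 1) = Y * β⁻¹ := by
      rw [hY, ← pow_sub_one_mul (by omega : m ≠ 0) β]
      field_simp
    have eP : 2 * ((β + β ^ (m - 1)) / (1 + β ^ m)) - (β + β⁻¹) = -(2 * τ * T) := by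
      rw [hpred, ← hβτ, ← hY, hT]
      have : 0 < 1 + Y := by linarith
      have : 0 < Y + 1 := by linarith
      field_simp
      ring
    have eR : 2 * ((β ^ (m - 1) - β) / (β ^ m - 1)) - (β + β⁻¹) = -(2 * τ / T) := by
      rw [hpred, ← hβτ, ← hY, hT]
      have : 0 < Y - 1 := by linarith
      have : 0 < Y + 1 := by linarith
      field_simp
      ring
    have hT0 : 0 < T := by linarith
    have hT1 : T < 1 := by
      rw [hT, div_lt_one (by linarith)]
      linarith
    refine ⟨_, _, _, ⟨PathProfile.exponential m (by omega) β (by linarith)⟩, ?_, ?_, ?_⟩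
    · have : τ / T ≤ 1 := (div_le_one hT0).mpr hτT
      have e : 2 * τ / T = 2 * (τ / T) := by ring
      linarith
    · have : 2 * τ * T < 2 * τ / T := by
        rw [lt_div_iff₀ hT0]
        have : T * T < 1 := by nlinarith
        nlinarith
      linarith
    · have hττ : 1 - 16 / k ^ 2 ≤ τ * τ := by
        have h16 : 4 / X ≤ 16 / k ^ 2 := by
          rw [div_le_div_iff₀ (by linarith) (by positivity)]
          linarith
        have e : 1 - τ * τ = 4 * X / (X + 1) ^ 2 := by
          rw [hτ]
          have : 0 < X + 1 := by linarith
          field_simp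
          ring
        have : 4 * X / (X + 1) ^ 2 ≤ 4 / X := by
          rw [div_le_div_iff₀ (by positivity) (by linarith)]
          nlinarith
        linarith
      have : τ * τ ≤ τ * T := by gcongr
      linarith

end PathLength

end PathForms

/-! ### Vertices on the inserted paths. -/

section ReplacedEdges

variable {V ι : Type*} {a b : ι → V} {m : ℕ}

theorem pathVertex_eq_inl_iff (hm : 1 ≤ m) {i : ι} {k : ℕ} {v : V} :
    pathVertex a b m i k = Sum.inl v ↔ k = 0 ∧ a i = v ∨ m ≤ k ∧ b i = v := by
  unfold pathVertex
  split_ifs with h1 h2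
  · simp [h1]
    omega
  · simp [h1]
    omega
  · simp [h1]
    omega

theorem pathVertex_eq_inr_iff {i i' : ι} {k : ℕ} {j : Fin (m - 1)} :
    pathVertex a b m i k = Sum.inr (i', j) ↔ i = i' ∧ k = j + 1 := by
  unfold pathVertex
  have hj := j.isLt
  split_ifs with h1 h2
  · simp [h1]
  · simp [Fin.ext_iff]
    omega
  · simp
    omega

theorem pathVertex_zero (i : ι) : pathVertex a b m i 0 = Sum.inl (a i) := by
  simp [pathVertex]

theorem pathVertex_last (hm : 1 ≤ m) (i : ι) : pathVertex a b m i m = Sum.inl (b i) :=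
  (pathVertex_eq_inl_iff hm).mpr (Or.inr ⟨le_rfl, rfl⟩)

theorem pathVertex_succ (i : ι) (j : Fin (m - 1)) :
    pathVertex a b m i (j + 1) = Sum.inr (i, j) :=
  pathVertex_eq_inr_iff.mpr ⟨rfl, rfl⟩

theorem pathVertex_succ_ne (hm : 2 ≤ m) {i : ι} {k : ℕ} (hk : k < m) :
    pathVertex a b m i k ≠ pathVertex a b m i (k + 1) := by
  intro h
  by_cases hk' : k + 1 < m
  · rw [show k + 1 = ((⟨k, by omega⟩ : Fin (m - 1)) : ℕ) + 1 from rfl, pathVertex_succ,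
      pathVertex_eq_inr_iff] at h
    simp at h
  · have : pathVertex a b m i k = Sum.inl (b i) := by
      rw [h, show k + 1 = m by omega, pathVertex_last (by omega)]
    rw [pathVertex_eq_inl_iff (by omega)] at this
    omega

end ReplacedEdges

/-! ### Edges, connectedness, order and degrees of the graph. -/

section AffinePathGraph

open AffGroup

variable {F : Type*} [Field F] {s : Fˣ} {t : AffGroup F} {m : ℕ}

/-- The starting vertices of the edges of `affinePathGraph s t m`, oriented from `g` to `g s` and
along the paths from `g` to `g t`. -/
def affineEdgeStart (t : AffGroup F) (m : ℕ) :
    AffGroup F ⊕ AffGroup F × Fin m → AffGroup F ⊕ AffGroup F × Fin (m - 1) :=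
  Sum.elim Sum.inl fun e => pathVertex (fun g => g) (fun g => g * t) m e.1 e.2

/-- The end vertices of the edges of `affinePathGraph s t m`, oriented from `g` to `g s` and
along the paths from `g` to `g t`. -/
def affineEdgeEnd (s : Fˣ) (t : AffGroup F) (m : ℕ) :
    AffGroup F ⊕ AffGroup F × Fin m → AffGroup F ⊕ AffGroup F × Fin (m - 1) :=
  Sum.elim (fun g => Sum.inl (g * dilation s))
    fun e => pathVertex (fun g => g) (fun g => g * t) m e.1 (e.2 + 1)

theorem dilation_ne_one (hs : s ≠ s⁻¹) : (dilation s : AffGroup F) ≠ 1 := by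
  intro h
  have h1 : s = 1 := congrArg SemidirectProduct.right h
  simp [h1] at hs

theorem dilation_sq_ne_one (hs : s ≠ s⁻¹) : (dilation s * dilation s : AffGroup F) ≠ 1 := by
  intro h
  rw [dilation_mul] at h
  have h1 : s * s = 1 := congrArg SemidirectProduct.right h
  exact hs (eq_inv_of_mul_eq_one_left h1)

theorem left_ne_zero_of_notMem_range
    (ht : t ∉ (SemidirectProduct.inr : Fˣ →* AffGroup F).range) : t.left.toAdd ≠ 0 :=
  fun h => ht ⟨t.right, ext_coords h.symm rfl⟩

theorem ne_one_of_notMem_range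
    (ht : t ∉ (SemidirectProduct.inr : Fˣ →* AffGroup F).range) : t ≠ 1 := by
  rintro rfl
  exact ht (one_mem _)

theorem affinePathGraph_adj_iff (hm : 2 ≤ m) (hs : s ≠ s⁻¹)
    (ht : t ∉ (SemidirectProduct.inr : Fˣ →* AffGroup F).range)
    {x y : AffGroup F ⊕ AffGroup F × Fin (m - 1)} :
    (affinePathGraph s t m).Adj x y ↔ ∃ e,
      x = affineEdgeStart t m e ∧ y = affineEdgeEnd s t m e ∨
      x = affineEdgeEnd s t m e ∧ y = affineEdgeStart t m e := by
  have hmem : (dilation s : AffGroup F) ∈ (SemidirectProduct.inr : Fˣ →* AffGroup F).range :=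
    ⟨s, rfl⟩
  have hcay : ∀ u v : AffGroup F,
      ((SimpleGraph.mulCayley
        ({SemidirectProduct.inr s, (SemidirectProduct.inr s)⁻¹, t, t⁻¹} : Set (AffGroup F))
        ).deleteEdges (Set.range fun g => s(g, g * t))).Adj u v ↔
        v = u * dilation s ∨ u = v * dilation s := by
    intro u v
    rw [SimpleGraph.deleteEdges_adj, SimpleGraph.mulCayley_adj']
    constructor
    · rintro ⟨⟨hne, x, hx, hxy⟩, hdel⟩
      have hdel1 : v ≠ u * t := by
        rintro rfl
        exact hdel ⟨u, rfl⟩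
      have hdel2 : u ≠ v * t := by
        rintro rfl
        exact hdel ⟨v, Sym2.eq_swap⟩
      rcases hx with rfl | rfl | rfl | rfl <;> rcases hxy with h | h
      · exact Or.inl h.symm
      · exact Or.inr h
      · exact Or.inr (mul_inv_eq_iff_eq_mul.mp h)
      · exact Or.inl (eq_mul_inv_iff_mul_eq.mp h).symm
      · exact absurd h.symm hdel1
      · exact absurd h hdel2
      · exact absurd (mul_inv_eq_iff_eq_mul.mp h) hdel2
      · exact absurd (eq_mul_inv_iff_mul_eq.mp h).symm hdel1
    -- An edge generated by $s$ could be among the replaced ones only if $t$ were $s$ or $s^{-1}$,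
    -- and both lie in the complement $F^\times$.
    · have key : ∀ u : AffGroup F, s(u, u * dilation s) ∉ Set.range fun g => s(g, g * t) := by
        rintro u ⟨g, hg⟩
        rcases Sym2.eq_iff.mp hg with ⟨h1, h2⟩ | ⟨h1, h2⟩
        · subst h1
          exact ht (mul_left_cancel h2 ▸ hmem)
        · have h3 : u * (dilation s * t) = u := by rw [← mul_assoc, ← h1, h2]
          have h4 := mul_eq_one_iff_inv_eq.mp (mul_eq_left.mp h3)
          exact ht (h4 ▸ inv_mem hmem)
      rintro (rfl | rfl)
      · exact ⟨⟨fun h => dilation_ne_one hs (mul_eq_left.mp h.symm), dilation s, Or.inl rfl,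
          Or.inl rfl⟩, key u⟩
      · refine ⟨⟨fun h => dilation_ne_one hs (mul_eq_left.mp h), dilation s, Or.inl rfl,
          Or.inr rfl⟩, ?_⟩
        rw [Sym2.eq_swap]
        exact key v
  have hrel : ∀ x y : AffGroup F ⊕ AffGroup F × Fin (m - 1),
      ((∃ u v, ((SimpleGraph.mulCayley
        ({SemidirectProduct.inr s, (SemidirectProduct.inr s)⁻¹, t, t⁻¹} : Set (AffGroup F))
        ).deleteEdges (Set.range fun g => s(g, g * t))).Adj u v ∧ x = Sum.inl u ∧ y = Sum.inl v) ∨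
      (∃ i, ∃ k < m, x = pathVertex (fun g => g) (fun g => g * t) m i k ∧
        y = pathVertex (fun g => g) (fun g => g * t) m i (k + 1))) →
      ∃ e, x = affineEdgeStart t m e ∧ y = affineEdgeEnd s t m e ∨
        x = affineEdgeEnd s t m e ∧ y = affineEdgeStart t m e := by
    rintro x y (⟨u, v, huv, rfl, rfl⟩ | ⟨g, k, hk, rfl, rfl⟩)
    · rcases (hcay u v).mp huv with rfl | rfl
      · exact ⟨Sum.inl u, Or.inl ⟨rfl, rfl⟩⟩
      · exact ⟨Sum.inl v, Or.inr ⟨rfl, rfl⟩⟩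
    · exact ⟨Sum.inr (g, ⟨k, hk⟩), Or.inl ⟨rfl, rfl⟩⟩
  unfold affinePathGraph replaceEdgesByPaths
  rw [SimpleGraph.fromRel_adj]
  constructor
  · rintro ⟨-, h | h⟩
    · exact hrel x y h
    · obtain ⟨e, he⟩ := hrel y x h
      exact ⟨e, he.symm.imp And.symm And.symm⟩
  · have hne : ∀ e, affineEdgeStart t m e ≠ affineEdgeEnd s t m e := by
      rintro (g | ⟨g, k⟩)
      · intro h
        exact dilation_ne_one hs (mul_eq_left.mp (Sum.inl_injective h).symm)
      · exact pathVertex_succ_ne (a := fun g => g) (b := fun g => g * t) hm k.isLt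
    rintro ⟨e, ⟨rfl, rfl⟩ | ⟨rfl, rfl⟩⟩
    · refine ⟨hne e, Or.inl ?_⟩
      rcases e with g | ⟨g, k⟩
      · exact Or.inl ⟨g, g * dilation s, (hcay _ _).mpr (Or.inl rfl), rfl, rfl⟩
      · exact Or.inr ⟨g, k, k.isLt, rfl, rfl⟩
    · refine ⟨(hne e).symm, Or.inr ?_⟩
      rcases e with g | ⟨g, k⟩
      · exact Or.inl ⟨g, g * dilation s, (hcay _ _).mpr (Or.inl rfl), rfl, rfl⟩
      · exact Or.inr ⟨g, k, k.isLt, rfl, rfl⟩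

/-- As $m\ge 2$, every path edge has an inner endpoint, which determines its path; its position and
the orientation then determine the edge. -/
theorem affineEdge_injective (hm : 2 ≤ m) {e e' : AffGroup F ⊕ AffGroup F × Fin m}
    (h1 : affineEdgeStart t m e = affineEdgeStart t m e')
    (h2 : affineEdgeEnd s t m e = affineEdgeEnd s t m e') : e = e' := by
  have hm1 : 1 ≤ m := by omega
  have mixed : ∀ (g g' : AffGroup F) (k : Fin m),
      Sum.inl g = pathVertex (fun g => g) (fun g => g * t) m g' k →
      Sum.inl (g * dilation s) = pathVertex (fun g => g) (fun g => g * t) m g' (k + 1) → False := by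
    intro g g' k h1 h2
    rw [eq_comm, pathVertex_eq_inl_iff hm1] at h1 h2
    have := k.isLt
    omega
  rcases e with g | ⟨g, k⟩ <;> rcases e' with g' | ⟨g', k'⟩ <;>
    simp only [affineEdgeStart, affineEdgeEnd, Sum.elim_inl, Sum.elim_inr] at h1 h2
  · exact congrArg Sum.inl (Sum.inl_injective h1)
  · exact (mixed _ _ _ h1 h2).elim
  · exact (mixed _ _ _ h1.symm h2.symm).elim
  · have hk := k.isLt
    have hk' := k'.isLt
    have : g = g' ∧ (k : ℕ) = k' := by
      by_cases hkm : (k : ℕ) + 1 < m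
      · rw [eq_comm, show (k : ℕ) + 1 = ((⟨k, by omega⟩ : Fin (m - 1)) : ℕ) + 1 from rfl,
          pathVertex_succ, pathVertex_eq_inr_iff] at h2
        exact ⟨h2.1.symm, by simpa using h2.2.symm⟩
      · rw [eq_comm, show (k : ℕ) = ((⟨k - 1, by omega⟩ : Fin (m - 1)) : ℕ) + 1 by simp; omega,
          pathVertex_succ, pathVertex_eq_inr_iff] at h1
        have := h1.2
        simp only at this
        exact ⟨h1.1.symm, by omega⟩
    rw [this.1, Fin.ext this.2]

/-- An $s$-edge equal to a reversed one would give $s^2=1$. Two path edges would share an inner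
vertex and hence a path; a reversal there would make the path close up, giving $t=1$, or reverse the
order of positions. -/
theorem affineEdge_ne_reverse (hm : 2 ≤ m) (hs : s ≠ s⁻¹)
    (ht : t ∉ (SemidirectProduct.inr : Fˣ →* AffGroup F).range)
    {e e' : AffGroup F ⊕ AffGroup F × Fin m}
    (h1 : affineEdgeStart t m e = affineEdgeEnd s t m e')
    (h2 : affineEdgeEnd s t m e = affineEdgeStart t m e') : False := by
  have hm1 : 1 ≤ m := by omega
  have ht1 := ne_one_of_notMem_range ht
  have mixed : ∀ (g g' g'' : AffGroup F) (k : Fin m),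
      Sum.inl g = pathVertex (fun g => g) (fun g => g * t) m g' (k + 1) →
      Sum.inl g'' = pathVertex (fun g => g) (fun g => g * t) m g' k → False := by
    intro g g' g'' k h1 h2
    rw [eq_comm, pathVertex_eq_inl_iff hm1] at h1 h2
    have := k.isLt
    omega
  rcases e with g | ⟨g, k⟩ <;> rcases e' with g' | ⟨g', k'⟩ <;>
    simp only [affineEdgeStart, affineEdgeEnd, Sum.elim_inl, Sum.elim_inr] at h1 h2
  · have h3 := Sum.inl_injective h1
    have h4 := Sum.inl_injective h2
    rw [h3, mul_assoc] at h4
    exact dilation_sq_ne_one hs (mul_eq_left.mp h4)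
  · exact mixed _ _ _ _ h1 h2
  · exact mixed _ _ _ _ h2.symm h1.symm
  · have hk := k.isLt
    have hk' := k'.isLt
    by_cases hkm : (k : ℕ) + 1 < m
    · rw [eq_comm, show (k : ℕ) + 1 = ((⟨k, by omega⟩ : Fin (m - 1)) : ℕ) + 1 from rfl,
        pathVertex_succ, pathVertex_eq_inr_iff] at h2
      obtain ⟨rfl, h3⟩ := h2
      simp only at h3
      by_cases hkm' : (k' : ℕ) + 1 < m
      · rw [show (k' : ℕ) + 1 = ((⟨k', by omega⟩ : Fin (m - 1)) : ℕ) + 1 from rfl,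
          pathVertex_succ, pathVertex_eq_inr_iff] at h1
        simp only at h1
        omega
      · rw [show (k' : ℕ) + 1 = m by omega, pathVertex_last hm1, pathVertex_eq_inl_iff hm1] at h1
        rcases h1 with ⟨-, h1⟩ | ⟨h1, -⟩
        · exact ht1 (mul_eq_left.mp h1.symm)
        · omega
    · rw [eq_comm, show (k : ℕ) = ((⟨k - 1, by omega⟩ : Fin (m - 1)) : ℕ) + 1 by simp; omega,
        pathVertex_succ, pathVertex_eq_inr_iff] at h1
      obtain ⟨rfl, h3⟩ := h1
      simp only at h3
      rw [show (k : ℕ) + 1 = m by omega, pathVertex_last hm1, eq_comm,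
        pathVertex_eq_inl_iff hm1] at h2
      rcases h2 with ⟨-, h2⟩ | ⟨h2, -⟩
      · exact ht1 (mul_eq_left.mp h2.symm)
      · omega

theorem affinePathGraph_connected (hm : 2 ≤ m) (hs : s ≠ s⁻¹)
    (ht : t ∉ (SemidirectProduct.inr : Fˣ →* AffGroup F).range)
    (hgen : Subgroup.zpowers s = ⊤) : (affinePathGraph s t m).Connected := by
  have hstep : ∀ e, (affinePathGraph s t m).Reachable (affineEdgeStart t m e)
      (affineEdgeEnd s t m e) := fun e =>
    ((affinePathGraph_adj_iff hm hs ht).mpr ⟨e, Or.inl ⟨rfl, rfl⟩⟩).reachable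
  have hpath : ∀ g k, k ≤ m → (affinePathGraph s t m).Reachable (Sum.inl g)
      (pathVertex (fun g => g) (fun g => g * t) m g k) := by
    intro g k hk
    induction k with
    | zero => rw [pathVertex_zero]
    | succ k ih => exact (ih (by omega)).trans (hstep (Sum.inr (g, ⟨k, by omega⟩)))
  -- Right multipliers that stay within a component form a subgroup; connectedness of the group
  -- vertices means that it is everything.
  let H : Subgroup (AffGroup F) :=
    { carrier := {x | ∀ g, (affinePathGraph s t m).Reachable (Sum.inl g) (Sum.inl (g * x))}
      one_mem' := fun g => by rw [mul_one]
      mul_mem' := fun {x y} hx hy g => by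
        rw [← mul_assoc]
        exact (hx g).trans (hy (g * x))
      inv_mem' := fun {x} hx g => by simpa using (hx (g * x⁻¹)).symm }
  have hsH : dilation s ∈ H := fun g => hstep (Sum.inl g)
  have htH : t ∈ H := fun g => by
    have h := hpath g m le_rfl
    rwa [pathVertex_last (by omega)] at h
  have hdil : ∀ u : Fˣ, dilation u ∈ H := by
    intro u
    have hu : u ∈ Subgroup.zpowers s := by rw [hgen]; trivial
    obtain ⟨n, rfl⟩ := Subgroup.mem_zpowers_iff.mp hu
    have : (dilation (s ^ n) : AffGroup F) = dilation s ^ n :=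
      map_zpow (SemidirectProduct.inr : Fˣ →* AffGroup F) s n
    rw [this]
    exact zpow_mem hsH n
  have hdecomp : ∀ x : AffGroup F, translation x.left.toAdd * dilation x.right = x := by
    intro x
    refine ext_coords ?_ ?_
    · rw [left_mul, left_translation, left_dilation, mul_zero, add_zero]
    · rw [right_mul, right_translation, right_dilation, one_mul]
  have hta : translation t.left.toAdd ∈ H := by
    have h := H.mul_mem htH (H.inv_mem (hdil t.right))
    rwa [← eq_mul_inv_of_mul_eq (hdecomp t)] at h
  have ht0 := left_ne_zero_of_notMem_range ht
  have htrans : ∀ a : F, translation a ∈ H := by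
    intro a
    by_cases ha : a = 0
    · rw [ha, translation_zero]
      exact H.one_mem
    -- Conjugating the translation part of $t$ by dilations reaches every nonzero translation.
    · let u : Fˣ := Units.mk0 (a / t.left.toAdd) (div_ne_zero ha ht0)
      have h := H.mul_mem (H.mul_mem (hdil u) hta) (H.inv_mem (hdil u))
      rw [dilation_mul_translation, mul_inv_cancel_right] at h
      have e : (u : F) * t.left.toAdd = a := div_mul_cancel₀ a ht0
      rwa [e] at h
  have hall : ∀ x, x ∈ H := fun x => hdecomp x ▸ H.mul_mem (htrans _) (hdil _)
  have hone : ∀ v, (affinePathGraph s t m).Reachable (Sum.inl 1) v := by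
    have h1 : ∀ g, (affinePathGraph s t m).Reachable (Sum.inl 1) (Sum.inl g) := fun g => by
      simpa using hall g 1
    rintro (g | ⟨g, j⟩)
    · exact h1 g
    · rw [← pathVertex_succ (a := fun g => g) (b := fun g => g * t) g j]
      exact (h1 g).trans (hpath g _ (by have := j.isLt; omega))
  exact { preconnected := fun v w => (hone v).symm.trans (hone w), nonempty := ⟨Sum.inl 1⟩ }

variable [Fintype F]

/-- The quadratic form of `affinePathGraph s t m` as a sum over its edges. -/
theorem dotProduct_adjOperator_affinePathGraph (hm : 2 ≤ m) (hs : s ≠ s⁻¹)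
    (ht : t ∉ (SemidirectProduct.inr : Fˣ →* AffGroup F).range)
    (f : AffGroup F ⊕ AffGroup F × Fin (m - 1) → ℝ) :
    f ⬝ᵥ adjOperator (affinePathGraph s t m) f =
      2 * ∑ g, f (Sum.inl g) * f (Sum.inl (g * dilation s)) +
      ∑ g, 2 * ∑ k ∈ Finset.range m, f (pathVertex (fun g => g) (fun g => g * t) m g k) *
        f (pathVertex (fun g => g) (fun g => g * t) m g (k + 1)) := by
  classical
  -- Each oriented edge taken in its two directions enumerates the adjacent ordered pairs without
  -- repetition.
  let Φ : (AffGroup F ⊕ AffGroup F × Fin m) ⊕ (AffGroup F ⊕ AffGroup F × Fin m) →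
      (AffGroup F ⊕ AffGroup F × Fin (m - 1)) × (AffGroup F ⊕ AffGroup F × Fin (m - 1)) :=
    Sum.elim (fun e => (affineEdgeStart t m e, affineEdgeEnd s t m e))
      fun e => (affineEdgeEnd s t m e, affineEdgeStart t m e)
  have hinj : Function.Injective Φ := by
    rintro (e | e) (e' | e') h <;> obtain ⟨h1, h2⟩ := Prod.ext_iff.mp h
    · exact congrArg Sum.inl (affineEdge_injective hm h1 h2)
    · exact (affineEdge_ne_reverse hm hs ht h1 h2).elim
    · exact (affineEdge_ne_reverse hm hs ht h2 h1).elim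
    · exact congrArg Sum.inr (affineEdge_injective hm h2 h1)
  have himage : Finset.univ.image Φ =
      Finset.univ.filter fun p => (affinePathGraph s t m).Adj p.1 p.2 := by
    ext ⟨x, y⟩
    simp only [Finset.mem_image, Finset.mem_univ, true_and, Finset.mem_filter,
      affinePathGraph_adj_iff hm hs ht, Sum.exists, Φ, Sum.elim_inl, Sum.elim_inr, Prod.mk.injEq]
    constructor
    · rintro ((⟨g, rfl, rfl⟩ | ⟨e, rfl, rfl⟩) | (⟨g, rfl, rfl⟩ | ⟨e, rfl, rfl⟩))
      · exact Or.inl ⟨g, Or.inl ⟨rfl, rfl⟩⟩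
      · exact Or.inr ⟨e, Or.inl ⟨rfl, rfl⟩⟩
      · exact Or.inl ⟨g, Or.inr ⟨rfl, rfl⟩⟩
      · exact Or.inr ⟨e, Or.inr ⟨rfl, rfl⟩⟩
    · rintro (⟨g, ⟨rfl, rfl⟩ | ⟨rfl, rfl⟩⟩ | ⟨e, ⟨rfl, rfl⟩ | ⟨rfl, rfl⟩⟩)
      · exact Or.inl (Or.inl ⟨g, rfl, rfl⟩)
      · exact Or.inr (Or.inl ⟨g, rfl, rfl⟩)
      · exact Or.inl (Or.inr ⟨e, rfl, rfl⟩)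
      · exact Or.inr (Or.inr ⟨e, rfl, rfl⟩)
  have hsum : f ⬝ᵥ adjOperator (affinePathGraph s t m) f =
      ∑ e, 2 * (f (affineEdgeStart t m e) * f (affineEdgeEnd s t m e)) := by
    calc f ⬝ᵥ adjOperator (affinePathGraph s t m) f
        = ∑ x, ∑ y, if (affinePathGraph s t m).Adj x y then f x * f y else 0 := by
          simp only [dotProduct, adjOperator, LinearMap.coe_mk, AddHom.coe_mk, Finset.mul_sum,
            mul_ite, mul_zero]
      _ = ∑ p ∈ Finset.univ.image Φ, f p.1 * f p.2 := by
          rw [himage, Finset.sum_filter, Fintype.sum_prod_type]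
      _ = _ := by
          rw [Finset.sum_image hinj.injOn, Fintype.sum_sum_type, ← Finset.sum_add_distrib]
          refine Finset.sum_congr rfl fun e _ => ?_
          simp only [Φ, Sum.elim_inl, Sum.elim_inr]
          ring
  rw [hsum, Fintype.sum_sum_type, Fintype.sum_prod_type, Finset.mul_sum]
  congr 1
  refine Finset.sum_congr rfl fun g _ => ?_
  rw [Finset.mul_sum, Finset.sum_range]
  rfl

theorem dotProduct_self_affinePathGraph (t : AffGroup F)
    (f : AffGroup F ⊕ AffGroup F × Fin (m - 1) → ℝ) :
    f ⬝ᵥ f = ∑ g, f (Sum.inl g) ^ 2 + ∑ g, ∑ k ∈ Finset.range (m - 1),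
      f (pathVertex (fun g => g) (fun g => g * t) m g (k + 1)) ^ 2 := by
  simp only [dotProduct, Fintype.sum_sum_type, Fintype.sum_prod_type, ← sq, Finset.sum_range,
    pathVertex_succ]

theorem card_affinePathGraph (hm : 2 ≤ m) :
    Fintype.card (AffGroup F ⊕ AffGroup F × Fin (m - 1)) =
      Fintype.card F * (Fintype.card F - 1) * m := by
  classical
  have h : Fintype.card (AffGroup F) = Fintype.card F * (Fintype.card F - 1) := by
    rw [Fintype.card_congr SemidirectProduct.equivProd, Fintype.card_prod, ← Fintype.card_units,
      Fintype.card_multiplicative]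
  rw [Fintype.card_sum, Fintype.card_prod, Fintype.card_fin, h]
  obtain ⟨M, rfl⟩ : ∃ M, m = M + 1 := ⟨m - 1, by omega⟩
  rw [Nat.add_sub_cancel]
  ring

theorem graphMaxDegree_affinePathGraph (hm : 2 ≤ m) (hs : s ≠ s⁻¹)
    (ht : t ∉ (SemidirectProduct.inr : Fˣ →* AffGroup F).range) :
    graphMaxDegree (affinePathGraph s t m) = 4 := by
  classical
  have hm1 : 1 ≤ m := by omega
  have ht1 := ne_one_of_notMem_range ht
  have hinl : ∀ g : AffGroup F, (affinePathGraph s t m).neighborFinset (Sum.inl g) =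
      {Sum.inl (g * dilation s), Sum.inl (g * (dilation s)⁻¹), Sum.inr (g, ⟨0, by omega⟩),
        Sum.inr (g * t⁻¹, ⟨m - 2, by omega⟩)} := by
    intro g
    ext y
    rw [SimpleGraph.mem_neighborFinset, affinePathGraph_adj_iff hm hs ht]
    simp only [Finset.mem_insert, Finset.mem_singleton]
    constructor
    · rintro ⟨g' | ⟨g', k⟩, ⟨h1, rfl⟩ | ⟨h1, rfl⟩⟩
      · cases h1
        exact Or.inl rfl
      · cases h1
        exact Or.inr (Or.inl (congrArg Sum.inl (by simp)))
      · have hk := k.isLt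
        simp only [affineEdgeStart, Sum.elim_inr] at h1
        rw [eq_comm, pathVertex_eq_inl_iff hm1] at h1
        rcases h1 with ⟨hk0, rfl⟩ | ⟨h, -⟩
        · refine Or.inr (Or.inr (Or.inl ?_))
          simp only [affineEdgeEnd, Sum.elim_inr]
          rw [pathVertex_eq_inr_iff]
          exact ⟨rfl, by rw [hk0]⟩
        · omega
      · have hk := k.isLt
        simp only [affineEdgeEnd, Sum.elim_inr] at h1
        rw [eq_comm, pathVertex_eq_inl_iff hm1] at h1
        rcases h1 with ⟨hk0, -⟩ | ⟨hkm, rfl⟩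
        · omega
        · refine Or.inr (Or.inr (Or.inr ?_))
          simp only [affineEdgeStart, Sum.elim_inr]
          rw [pathVertex_eq_inr_iff]
          exact ⟨by simp, by simp only; omega⟩
    · rintro (rfl | rfl | rfl | rfl)
      · exact ⟨Sum.inl g, Or.inl ⟨rfl, rfl⟩⟩
      · exact ⟨Sum.inl (g * (dilation s)⁻¹), Or.inr ⟨by simp [affineEdgeEnd], rfl⟩⟩
      · refine ⟨Sum.inr (g, ⟨0, by omega⟩), Or.inl ⟨?_, ?_⟩⟩
        · simp [affineEdgeStart, pathVertex_zero]
        · simp only [affineEdgeEnd, Sum.elim_inr]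
          exact (pathVertex_eq_inr_iff.mpr ⟨rfl, rfl⟩).symm
      · refine ⟨Sum.inr (g * t⁻¹, ⟨m - 1, by omega⟩), Or.inr ⟨?_, ?_⟩⟩
        · simp only [affineEdgeEnd, Sum.elim_inr]
          exact ((pathVertex_eq_inl_iff hm1).mpr (Or.inr ⟨by omega, by simp⟩)).symm
        · simp only [affineEdgeStart, Sum.elim_inr]
          exact (pathVertex_eq_inr_iff.mpr ⟨rfl, by simp only; omega⟩).symm
  have hdeg : ∀ g : AffGroup F, (affinePathGraph s t m).degree (Sum.inl g) = 4 := by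
    intro g
    rw [← SimpleGraph.card_neighborFinset_eq_degree, hinl]
    have h1 : g * dilation s ≠ g * (dilation s)⁻¹ := fun h =>
      dilation_sq_ne_one hs (eq_inv_iff_mul_eq_one.mp (mul_left_cancel h))
    -- For $m=2$ the inner indices $0$ and $m-2$ coincide, so the two path neighbours are told apart
    -- by their paths.
    have h2 : g ≠ g * t⁻¹ := fun h => ht1 (inv_eq_one.mp (mul_eq_left.mp h.symm))
    rw [Finset.card_insert_of_notMem, Finset.card_insert_of_notMem, Finset.card_insert_of_notMem,
      Finset.card_singleton]
    · simp [h2]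
    · simp
    · simp [h1]
  have hdeg2 : ∀ p : AffGroup F × Fin (m - 1),
      (affinePathGraph s t m).degree (Sum.inr p) ≤ 4 := by
    rintro ⟨g, j⟩
    have hsub : (affinePathGraph s t m).neighborFinset (Sum.inr (g, j)) ⊆
        {pathVertex (fun g => g) (fun g => g * t) m g j,
          pathVertex (fun g => g) (fun g => g * t) m g (j + 2)} := by
      intro y hy
      rw [SimpleGraph.mem_neighborFinset, affinePathGraph_adj_iff hm hs ht] at hy
      simp only [Finset.mem_insert, Finset.mem_singleton]
      obtain ⟨g' | ⟨g', k⟩, ⟨h1, rfl⟩ | ⟨h1, rfl⟩⟩ := hy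
      · cases h1
      · cases h1
      · simp only [affineEdgeStart, Sum.elim_inr] at h1
        rw [eq_comm, pathVertex_eq_inr_iff] at h1
        obtain ⟨rfl, hk⟩ := h1
        right
        simp only [affineEdgeEnd, Sum.elim_inr, hk]
      · simp only [affineEdgeEnd, Sum.elim_inr] at h1
        rw [eq_comm, pathVertex_eq_inr_iff] at h1
        obtain ⟨rfl, hk⟩ := h1
        left
        simp only [affineEdgeStart, Sum.elim_inr, Nat.succ_injective hk]
    rw [← SimpleGraph.card_neighborFinset_eq_degree]
    exact (Finset.card_le_card hsub).trans (Finset.card_le_two.trans (by norm_num))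
  have hmax : (affinePathGraph s t m).maxDegree = 4 := by
    refine le_antisymm (SimpleGraph.maxDegree_le_of_forall_degree_le _ _ ?_) ?_
    · rintro (g | p)
      · exact (hdeg g).le
      · exact hdeg2 p
    · rw [← hdeg 1]
      exact SimpleGraph.degree_le_maxDegree _ _
  unfold graphMaxDegree
  convert hmax

end AffinePathGraph

/-! ### The group action and the two form bounds around the threshold. -/

section SecondEigenvalue

open AffGroup Module

variable {F : Type*} [Field F] {s : Fˣ} {t : AffGroup F} {m : ℕ}

/-- Left multiplication on the vertices of `affinePathGraph s t m`. -/
def affineVertexMul (m : ℕ) (γ : AffGroup F) :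
    AffGroup F ⊕ AffGroup F × Fin (m - 1) → AffGroup F ⊕ AffGroup F × Fin (m - 1) :=
  Sum.map (γ * ·) (Prod.map (γ * ·) id)

theorem affineVertexMul_mul (γ δ : AffGroup F) (v : AffGroup F ⊕ AffGroup F × Fin (m - 1)) :
    affineVertexMul m (γ * δ) v = affineVertexMul m γ (affineVertexMul m δ v) := by
  rcases v with g | ⟨g, j⟩ <;> simp [affineVertexMul, mul_assoc]

theorem affineVertexMul_one (v : AffGroup F ⊕ AffGroup F × Fin (m - 1)) :
    affineVertexMul m 1 v = v := by
  rcases v with g | ⟨g, j⟩ <;> simp [affineVertexMul]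

/-- Left multiplication as a permutation of the vertices of `affinePathGraph s t m`. -/
def affineVertexEquiv (m : ℕ) (γ : AffGroup F) :
    Equiv.Perm (AffGroup F ⊕ AffGroup F × Fin (m - 1)) where
  toFun := affineVertexMul m γ
  invFun := affineVertexMul m γ⁻¹
  left_inv v := by rw [← affineVertexMul_mul, inv_mul_cancel, affineVertexMul_one]
  right_inv v := by rw [← affineVertexMul_mul, mul_inv_cancel, affineVertexMul_one]

theorem affineVertexMul_pathVertex (γ g : AffGroup F) (k : ℕ) :
    affineVertexMul m γ (pathVertex (fun g => g) (fun g => g * t) m g k) =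
      pathVertex (fun g => g) (fun g => g * t) m (γ * g) k := by
  unfold pathVertex
  split_ifs <;> simp [affineVertexMul, mul_assoc]

theorem affinePathGraph_adj_affineVertexMul (hm : 2 ≤ m) (hs : s ≠ s⁻¹)
    (ht : t ∉ (SemidirectProduct.inr : Fˣ →* AffGroup F).range) (γ : AffGroup F)
    {x y : AffGroup F ⊕ AffGroup F × Fin (m - 1)} (h : (affinePathGraph s t m).Adj x y) :
    (affinePathGraph s t m).Adj (affineVertexMul m γ x) (affineVertexMul m γ y) := by
  rw [affinePathGraph_adj_iff hm hs ht] at h ⊢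
  have hstart : ∀ e, affineVertexMul m γ (affineEdgeStart t m e) =
      affineEdgeStart t m (Sum.map (γ * ·) (Prod.map (γ * ·) id) e) := by
    rintro (g | ⟨g, k⟩)
    · rfl
    · exact affineVertexMul_pathVertex γ g k
  have hend : ∀ e, affineVertexMul m γ (affineEdgeEnd s t m e) =
      affineEdgeEnd s t m (Sum.map (γ * ·) (Prod.map (γ * ·) id) e) := by
    rintro (g | ⟨g, k⟩)
    · exact congrArg Sum.inl (mul_assoc _ _ _).symm
    · exact affineVertexMul_pathVertex γ g (k + 1)
  obtain ⟨e, ⟨rfl, rfl⟩ | ⟨rfl, rfl⟩⟩ := h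
  · exact ⟨_, Or.inl ⟨hstart e, hend e⟩⟩
  · exact ⟨_, Or.inr ⟨hend e, hstart e⟩⟩

/-- The affine group acts on the functions on the vertices of `affinePathGraph s t m`. -/
def affineVertexRep (F : Type*) [Field F] (m : ℕ) :
    AffGroup F →* End ℝ (AffGroup F ⊕ AffGroup F × Fin (m - 1) → ℝ) where
  toFun γ :=
    { toFun := fun f v => f (affineVertexMul m γ⁻¹ v)
      map_add' := fun _ _ => rfl
      map_smul' := fun _ _ => rfl }
  map_one' := by
    ext f v
    simp [affineVertexMul_one]
  map_mul' γ δ := by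
    refine LinearMap.ext fun f => funext fun v => ?_
    simp [affineVertexMul_mul]

theorem affineVertexRep_apply (γ : AffGroup F) (f : AffGroup F ⊕ AffGroup F × Fin (m - 1) → ℝ)
    (v : AffGroup F ⊕ AffGroup F × Fin (m - 1)) :
    affineVertexRep F m γ f v = f (affineVertexMul m γ⁻¹ v) := rfl

/-- The functions on the vertices that are invariant under translations. -/
def translationInvariants (F : Type*) [Field F] (m : ℕ) :
    Submodule ℝ (AffGroup F ⊕ AffGroup F × Fin (m - 1) → ℝ) where
  carrier := {f | ∀ a, affineVertexRep F m (translation a) f = f}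
  add_mem' hf hg a := by rw [map_add, hf a, hg a]
  zero_mem' a := map_zero _
  smul_mem' c f hf a := by rw [map_smul, hf a]

theorem apply_inl_of_mem_translationInvariants
    {f : AffGroup F ⊕ AffGroup F × Fin (m - 1) → ℝ} (hf : f ∈ translationInvariants F m)
    (g : AffGroup F) : f (Sum.inl g) = f (Sum.inl (dilation g.right)) := by
  conv_lhs => rw [← hf g.left.toAdd, affineVertexRep_apply]
  refine congrArg f (congrArg Sum.inl ?_)
  rw [inv_mul_eq_iff_eq_mul]
  refine ext_coords ?_ ?_
  · rw [left_mul, left_translation, left_dilation, mul_zero, add_zero]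
  · rw [right_mul, right_translation, right_dilation, one_mul]

/-- The function on the vertices of `affinePathGraph s t m` with value `φ (g 0)` at a vertex `g` of
the affine group, interpolated along the paths. -/
noncomputable def interpolant {μ P R : ℝ} (hprof : PathProfile m μ P R) (t : AffGroup F)
    (φ : F → ℝ) : AffGroup F ⊕ AffGroup F × Fin (m - 1) → ℝ :=
  Sum.elim (fun g => φ g.left.toAdd)
    fun p => hprof.interp (φ p.1.left.toAdd) (φ (p.1 * t).left.toAdd) (p.2 + 1)

theorem interpolant_pathVertex {μ P R : ℝ} (hprof : PathProfile m μ P R) (φ : F → ℝ)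
    (g : AffGroup F) {k : ℕ} (hk : k ≤ m) :
    interpolant hprof t φ (pathVertex (fun g => g) (fun g => g * t) m g k) =
      hprof.interp (φ g.left.toAdd) (φ (g * t).left.toAdd) k := by
  unfold pathVertex
  split_ifs with h1 h2
  · rw [h1, hprof.interp_zero]
    rfl
  · simp only [interpolant, Sum.elim_inr]
    rw [show k - 1 + 1 = k by omega]
  · obtain rfl : k = m := by omega
    rw [hprof.interp_last]
    rfl

theorem interpolant_smul_add {μ P R : ℝ} (hprof : PathProfile m μ P R) (φ ψ : F → ℝ) (a b : ℝ) :
    a • interpolant hprof t φ + b • interpolant hprof t ψ =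
      interpolant hprof t (a • φ + b • ψ) := by
  ext v
  rcases v with g | ⟨g, j⟩
  · rfl
  · simp only [interpolant, Pi.add_apply, Pi.smul_apply, smul_eq_mul, Sum.elim_inr,
      hprof.interp_smul_add]

/-- The affine group is doubly transitive and $t$ moves $0$, so $(g\cdot 0, gt\cdot 0)$ takes every
pair of distinct values. Three points with pairwise sums zero force all values to vanish. -/
theorem eq_zero_of_forall_left_add_eq_zero (hcard : ∃ x y z : F, x ≠ y ∧ x ≠ z ∧ y ≠ z)
    (ht : t ∉ (SemidirectProduct.inr : Fˣ →* AffGroup F).range) {φ : F → ℝ}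
    (h : ∀ g : AffGroup F, φ g.left.toAdd + φ (g * t).left.toAdd = 0) : φ = 0 := by
  have ht0 := left_ne_zero_of_notMem_range ht
  have hpair : ∀ x y : F, x ≠ y → φ x + φ y = 0 := by
    intro x y hxy
    have h0 : (y - x) / t.left.toAdd ≠ 0 := div_ne_zero (sub_ne_zero.mpr hxy.symm) ht0
    have hg := h (translation x * dilation (Units.mk0 _ h0))
    simp only [left_mul, left_translation, right_mul, right_translation, left_dilation,
      right_dilation, Units.val_one, one_mul, mul_zero, add_zero, Units.val_mk0,
      div_mul_cancel₀ _ ht0, add_sub_cancel] at hg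
    exact hg
  obtain ⟨x, y, z, hxy, hxz, hyz⟩ := hcard
  have h1 := hpair x y hxy
  have h2 := hpair x z hxz
  have h3 := hpair y z hyz
  have hx : φ x = 0 := by linarith
  ext w
  by_cases hw : w = x
  · rw [hw, hx]
    rfl
  · have := hpair w x hw
    simp only [Pi.zero_apply]
    linarith

variable [Fintype F]

theorem adjOperator_affineVertexRep (hm : 2 ≤ m) (hs : s ≠ s⁻¹)
    (ht : t ∉ (SemidirectProduct.inr : Fˣ →* AffGroup F).range) (γ : AffGroup F)
    (f : AffGroup F ⊕ AffGroup F × Fin (m - 1) → ℝ) :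
    adjOperator (affinePathGraph s t m) (affineVertexRep F m γ f) =
      affineVertexRep F m γ (adjOperator (affinePathGraph s t m) f) := by
  classical
  ext x
  rw [affineVertexRep_apply]
  simp only [adjOperator, LinearMap.coe_mk, AddHom.coe_mk]
  refine Fintype.sum_equiv (affineVertexEquiv m γ⁻¹) _ _ fun y => ?_
  have hiff : (affinePathGraph s t m).Adj x y ↔
      (affinePathGraph s t m).Adj (affineVertexMul m γ⁻¹ x) (affineVertexMul m γ⁻¹ y) := by
    refine ⟨affinePathGraph_adj_affineVertexMul hm hs ht γ⁻¹, fun h => ?_⟩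
    have h2 := affinePathGraph_adj_affineVertexMul hm hs ht γ h
    simpa only [← affineVertexMul_mul, mul_inv_cancel, affineVertexMul_one] using h2
  simp only [hiff]
  rfl

theorem card_sub_one_le_finrank_eigenspace (hm : 2 ≤ m) (hs : s ≠ s⁻¹)
    (ht : t ∉ (SemidirectProduct.inr : Fˣ →* AffGroup F).range) {c : ℝ}
    {f : AffGroup F ⊕ AffGroup F × Fin (m - 1) → ℝ}
    (hf : f ∈ End.eigenspace (adjOperator (affinePathGraph s t m)) c)
    (hfN : f ∉ translationInvariants F m) :
    Fintype.card F - 1 ≤ finrank ℝ (End.eigenspace (adjOperator (affinePathGraph s t m)) c) := by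
  obtain ⟨b, hb⟩ : ∃ b, affineVertexRep F m (translation b) f ≠ f := by
    by_contra! h
    exact hfN h
  refine card_units_le_finrank (affineVertexRep F m) _ (fun γ h hh => ?_) hf hb
  rw [End.mem_eigenspace_iff] at hh ⊢
  rw [adjOperator_affineVertexRep hm hs ht, hh, map_smul]

theorem sum_right (ψ : Fˣ → ℝ) [Fintype Fˣ] :
    ∑ g : AffGroup F, ψ g.right = Fintype.card F * ∑ u, ψ u := by
  have h : ∑ g : AffGroup F, ψ g.right = ∑ p : Multiplicative F × Fˣ, ψ p.2 :=
    Fintype.sum_equiv SemidirectProduct.equivProd _ _ fun _ => rfl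
  rw [h, Fintype.sum_prod_type]
  simp

/-- Upper bound for the quadratic form on functions that are invariant under translations. -/
theorem dotProduct_adjOperator_le_of_mem_translationInvariants (hm : 2 ≤ m) (hs : s ≠ s⁻¹)
    (ht : t ∉ (SemidirectProduct.inr : Fˣ →* AffGroup F).range)
    (hgen : Subgroup.zpowers s = ⊤) {μ P R : ℝ} (hprof : PathProfile m μ P R)
    (hP : 2 * Real.cos (2 * Real.pi / ((Fintype.card F : ℝ) - 1)) - μ + 2 * P ≤ 0)
    {f : AffGroup F ⊕ AffGroup F × Fin (m - 1) → ℝ} (hf : f ∈ translationInvariants F m)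
    (hsum : ∑ g, f (Sum.inl g) = 0) :
    f ⬝ᵥ adjOperator (affinePathGraph s t m) f ≤ μ * (f ⬝ᵥ f) := by
  classical
  have hinv := apply_inl_of_mem_translationInvariants hf
  have hq : (0 : ℝ) < Fintype.card F := by exact_mod_cast Fintype.card_pos
  -- On group vertices an invariant function depends only on the coordinate in $F^\times$, a cyclic
  -- group generated by $s$, where the Wirtinger inequality applies.
  have hcyc : ∑ g, f (Sum.inl g) * f (Sum.inl (g * dilation s)) ≤
      Real.cos (2 * Real.pi / ((Fintype.card F : ℝ) - 1)) * ∑ g, f (Sum.inl g) ^ 2 := by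
    let ψ : Fˣ → ℝ := fun u => f (Sum.inl (dilation u))
    have hψ : ∀ g : AffGroup F, f (Sum.inl g) = ψ g.right := hinv
    simp only [hψ, right_mul, right_dilation] at hsum ⊢
    rw [sum_right ψ] at hsum
    rw [sum_right fun u => ψ u * ψ (u * s), sum_right fun u => ψ u ^ 2]
    have h := sum_mul_shift_le_of_zpowers_eq_top s hgen ψ
      ((mul_eq_zero.mp hsum).resolve_left hq.ne')
    rw [Fintype.card_units, Nat.cast_sub Fintype.card_pos, Nat.cast_one] at h
    rw [mul_left_comm]
    exact mul_le_mul_of_nonneg_left h hq.le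
  have hpath : ∀ g : AffGroup F, _ := fun g => hprof.sum_mul_succ_le (by omega)
    fun k => f (pathVertex (fun g => g) (fun g => g * t) m g k)
  simp only [pathVertex_zero, pathVertex_last (show 1 ≤ m by omega)] at hpath
  have hpaths := Finset.sum_le_sum fun g (_ : g ∈ Finset.univ) => hpath g
  have hshift : ∑ g, f (Sum.inl (g * t)) ^ 2 = ∑ g, f (Sum.inl g) ^ 2 :=
    Fintype.sum_equiv (Equiv.mulRight t) _ _ fun _ => rfl
  rw [Finset.sum_add_distrib, ← Finset.mul_sum, ← Finset.mul_sum, ← Finset.mul_sum,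
    Finset.sum_add_distrib, hshift] at hpaths
  rw [dotProduct_adjOperator_affinePathGraph hm hs ht, dotProduct_self_affinePathGraph t,
    ← Finset.mul_sum]
  have hnn : 0 ≤ ∑ g, f (Sum.inl g) ^ 2 := Finset.sum_nonneg fun g _ => sq_nonneg _
  have := mul_nonpos_of_nonpos_of_nonneg hP hnn
  linarith

/-- Lower bound for the quadratic form on the interpolants. -/
theorem lt_dotProduct_adjOperator_interpolant (hm : 2 ≤ m) (hs : s ≠ s⁻¹)
    (ht : t ∉ (SemidirectProduct.inr : Fˣ →* AffGroup F).range)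
    (hcard : ∃ x y z : F, x ≠ y ∧ x ≠ z ∧ y ≠ z) {μ P R : ℝ} (hprof : PathProfile m μ P R)
    (hR : 0 ≤ 2 - μ + 2 * R) (hRP : R < P) {φ : F → ℝ} (hφ : φ ≠ 0) :
    μ * (interpolant hprof t φ ⬝ᵥ interpolant hprof t φ) <
      interpolant hprof t φ ⬝ᵥ adjOperator (affinePathGraph s t m) (interpolant hprof t φ) := by
  have hm1 : 1 ≤ m := by omega
  rw [dotProduct_adjOperator_affinePathGraph hm hs ht, dotProduct_self_affinePathGraph t]
  have hinl : ∀ g : AffGroup F, interpolant hprof t φ (Sum.inl g) = φ g.left.toAdd := fun _ => rfl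
  have hself : ∀ g : AffGroup F, ∑ k ∈ Finset.range (m - 1),
      interpolant hprof t φ (pathVertex (fun g => g) (fun g => g * t) m g (k + 1)) ^ 2 =
      ∑ k ∈ Finset.range (m - 1),
        hprof.interp (φ g.left.toAdd) (φ (g * t).left.toAdd) (k + 1) ^ 2 := by
    intro g
    refine Finset.sum_congr rfl fun k hk => ?_
    have := Finset.mem_range.mp hk
    rw [interpolant_pathVertex hprof φ g (by omega)]
  have hpath : ∀ g : AffGroup F, 2 * ∑ k ∈ Finset.range m,
      interpolant hprof t φ (pathVertex (fun g => g) (fun g => g * t) m g k) *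
        interpolant hprof t φ (pathVertex (fun g => g) (fun g => g * t) m g (k + 1)) =
      μ * ∑ k ∈ Finset.range (m - 1),
        hprof.interp (φ g.left.toAdd) (φ (g * t).left.toAdd) (k + 1) ^ 2 +
        (R * (φ g.left.toAdd ^ 2 + φ (g * t).left.toAdd ^ 2) +
          (P - R) / 2 * (φ g.left.toAdd + φ (g * t).left.toAdd) ^ 2) := by
    intro g
    rw [← hprof.sum_interp_mul_succ hm1]
    congr 1
    refine Finset.sum_congr rfl fun k hk => ?_
    have := Finset.mem_range.mp hk
    rw [interpolant_pathVertex hprof φ g (by omega), interpolant_pathVertex hprof φ g (by omega)]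
  -- Dilations fix $0$, so $gs\cdot 0=g\cdot 0$ and each $s$-edge contributes the full square; this
  -- is the $2$ in $2-\mu+2R$.
  have hleft : ∀ g : AffGroup F, (g * dilation s).left.toAdd = g.left.toAdd := fun g => by
    rw [left_mul, left_dilation, mul_zero, add_zero]
  have hshift : ∑ g : AffGroup F, φ (g * t).left.toAdd ^ 2 =
      ∑ g : AffGroup F, φ g.left.toAdd ^ 2 :=
    Fintype.sum_equiv (Equiv.mulRight t) _ _ fun _ => rfl
  simp only [hinl, hself, hpath, hleft, ← sq]
  simp only [Finset.sum_add_distrib, ← Finset.mul_sum, hshift]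
  have hnn : 0 ≤ ∑ g : AffGroup F, φ g.left.toAdd ^ 2 := Finset.sum_nonneg fun g _ => sq_nonneg _
  have hpos : 0 < ∑ g : AffGroup F, (φ g.left.toAdd + φ (g * t).left.toAdd) ^ 2 := by
    refine lt_of_le_of_ne (Finset.sum_nonneg fun g _ => sq_nonneg _) fun h => hφ ?_
    have h2 := (Finset.sum_eq_zero_iff_of_nonneg fun g _ => sq_nonneg _).mp h.symm
    exact eq_zero_of_forall_left_add_eq_zero hcard ht fun g =>
      pow_eq_zero_iff two_ne_zero |>.mp (h2 g (Finset.mem_univ _))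
  have h1 := mul_nonneg hR hnn
  have h2 := mul_pos (half_pos (sub_pos.mpr hRP)) hpos
  linarith

theorem ne_inv_of_zpowers_eq_top (hgen : Subgroup.zpowers s = ⊤) (hq : 4 ≤ Fintype.card F) :
    s ≠ s⁻¹ := by
  classical
  intro h
  have h2 : s ^ 2 = 1 := by
    rw [sq]
    exact eq_inv_iff_mul_eq_one.mp h
  have hord : orderOf s = Fintype.card Fˣ := by
    rw [← Nat.card_zpowers, hgen, Nat.card_congr Subgroup.topEquiv.toEquiv,
      Nat.card_eq_fintype_card]
  have := orderOf_le_of_pow_eq_one (by norm_num) h2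
  rw [hord, Fintype.card_units] at this
  omega

theorem card_sub_one_le_secondEigenvalueMultiplicity (hgen : Subgroup.zpowers s = ⊤)
    (hq : 4 ≤ Fintype.card F) (ht : t ∉ (SemidirectProduct.inr : Fˣ →* AffGroup F).range) :
    Fintype.card F - 1 ≤
      secondEigenvalueMultiplicity (affinePathGraph s t (pathLength (Fintype.card F))) := by
  classical
  have hs := ne_inv_of_zpowers_eq_top hgen hq
  have hm := (pathLength_add_two hq).1
  obtain ⟨μ, P, R, ⟨hprof⟩, hR, hRP, hP⟩ := exists_pathProfile hq
  have hcard : ∃ x y z : F, x ≠ y ∧ x ≠ z ∧ y ≠ z := by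
    obtain ⟨x, y, z, h⟩ := Fintype.two_lt_card_iff.mp (show 2 < Fintype.card F by omega)
    exact ⟨x, y, z, h⟩
  -- The plane consists of the interpolants of functions supported on $\{0,1\}\subset F$. The
  -- functional sums over the group vertices only, since the cyclic inequality needs nothing about
  -- the path values.
  refine le_secondEigenvalueMultiplicity _ ?_ (μ := μ) (by omega)
    (interpolant hprof t (Pi.single 0 1)) (interpolant hprof t (Pi.single 1 1)) ?_
    (translationInvariants F _) (∑ g : AffGroup F, LinearMap.proj (Sum.inl g)) ?_ ?_
  · rw [card_affinePathGraph hm]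
    have : 4 * (4 - 1) * 2 ≤ Fintype.card F * (Fintype.card F - 1) * pathLength (Fintype.card F) :=
      Nat.mul_le_mul (Nat.mul_le_mul hq (by omega)) hm
    omega
  · intro a b hab
    rw [interpolant_smul_add]
    refine lt_dotProduct_adjOperator_interpolant hm hs ht hcard hprof hR hRP fun h => ?_
    have h0 := congrFun h 0
    have h1 := congrFun h 1
    simp at h0 h1
    exact hab.elim (fun h => h h0) fun h => h h1
  · intro f hf hsum
    refine dotProduct_adjOperator_le_of_mem_translationInvariants hm hs ht hgen hprof hP hf ?_
    simpa using hsum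
  · exact fun c f hf hfN => card_sub_one_le_finrank_eigenspace hm hs ht hf hfN

end SecondEigenvalue

/-! ### Invariance under graph isomorphism. -/

section Isomorphisms

/-- Isomorphic graphs have the same characteristic polynomial, and its sorted roots are the
eigenvalue list. Comparing lists avoids transport between the two index types `Fin`. -/
theorem secondEigenvalueMultiplicity_congr {V W : Type*} [Fintype V] [Fintype W]
    {G : SimpleGraph V} {H : SimpleGraph W} (e : G ≃g H) :
    secondEigenvalueMultiplicity G = secondEigenvalueMultiplicity H := by
  classical
  have hmat : H.adjMatrix ℝ = Matrix.reindex e.toEquiv e.toEquiv (G.adjMatrix ℝ) := by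
    ext x y
    simp only [SimpleGraph.adjMatrix_apply, Matrix.reindex_apply, Matrix.submatrix_apply]
    congr 1
    exact propext (e.symm.map_adj_iff).symm
  have hchar : (H.adjMatrix ℝ).charpoly = (G.adjMatrix ℝ).charpoly := by
    rw [hmat, Matrix.charpoly_reindex]
  have hlist : List.ofFn (adjEigenvalue G) = List.ofFn (adjEigenvalue H) := by
    unfold adjEigenvalue
    rw [← Matrix.IsHermitian.sort_roots_charpoly_eq_eigenvalues₀,
      ← Matrix.IsHermitian.sort_roots_charpoly_eq_eigenvalues₀, hchar]
  have hsigma := List.ofFn_inj'.mp hlist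
  exact congrArg (fun p : (Σ n, Fin n → ℝ) =>
    Nat.card {j : Fin p.1 // ∃ h : 1 < p.1, p.2 j = p.2 ⟨1, h⟩}) hsigma

theorem graphMaxDegree_congr {V W : Type*} [Fintype V] [Fintype W]
    {G : SimpleGraph V} {H : SimpleGraph W} (e : G ≃g H) : graphMaxDegree G = graphMaxDegree H := by
  classical
  unfold graphMaxDegree
  exact e.maxDegree_eq

end Isomorphisms

/-! ### Assembly, and the infinite family from prime fields. -/

theorem affinePathGraph_spec (F : Type) [Field F] [Fintype F] (q m n : ℕ) (s : Fˣ)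
    (t : AffGroup F) (hq : q = Fintype.card F) (hq4 : 4 ≤ q) (hm : m = pathLength q)
    (hn : n = q * (q - 1) * m) (hgen : Subgroup.zpowers s = ⊤)
    (ht : t ∉ (SemidirectProduct.inr : Fˣ →* AffGroup F).range) :
    Fintype.card (AffGroup F ⊕ AffGroup F × Fin (m - 1)) = n ∧
      (affinePathGraph s t m).Connected ∧
      graphMaxDegree (affinePathGraph s t m) = 4 ∧
      q - 1 ≤ secondEigenvalueMultiplicity (affinePathGraph s t m) ∧
      √((n : ℝ) / Real.logb 2 (n : ℝ)) ≤
        (secondEigenvalueMultiplicity (affinePathGraph s t m) : ℝ) := by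
  subst hq hm hn
  have hs := ne_inv_of_zpowers_eq_top hgen hq4
  have hm := (pathLength_add_two hq4).1
  have hmult := card_sub_one_le_secondEigenvalueMultiplicity hgen hq4 ht
  refine ⟨card_affinePathGraph hm, affinePathGraph_connected hm hs ht hgen,
    graphMaxDegree_affinePathGraph hm hs ht, hmult, (sqrt_card_div_logb_le hq4).trans ?_⟩
  have h : ((Fintype.card F - 1 : ℕ) : ℝ) ≤ _ := Nat.cast_le.mpr hmult
  rwa [Nat.cast_sub (by omega), Nat.cast_one] at h

theorem theorem1p5 :
    {n : ℕ | ∃ G : SimpleGraph (Fin n), G.Connected ∧ graphMaxDegree G = 4 ∧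
      √((n : ℝ) / Real.logb 2 (n : ℝ)) ≤ (secondEigenvalueMultiplicity G : ℝ)}.Infinite ∧
    ∀ (F : Type) [Field F] [Fintype F] (q m n : ℕ) (s : Fˣ) (t : AffGroup F),
      q = Fintype.card F → 4 ≤ q → m = pathLength q → n = q * (q - 1) * m →
      Subgroup.zpowers s = ⊤ →
      t ∉ (SemidirectProduct.inr : Fˣ →* AffGroup F).range → t ≠ t⁻¹ →
      Fintype.card (AffGroup F ⊕ AffGroup F × Fin (m - 1)) = n ∧
      (affinePathGraph s t m).Connected ∧
      graphMaxDegree (affinePathGraph s t m) = 4 ∧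
      q - 1 ≤ secondEigenvalueMultiplicity (affinePathGraph s t m) ∧
      √((n : ℝ) / Real.logb 2 (n : ℝ)) ≤
        (secondEigenvalueMultiplicity (affinePathGraph s t m) : ℝ) := by
  refine ⟨?_, fun F _ _ q m n s t hq hq4 hm hn hgen ht _ =>
    affinePathGraph_spec F q m n s t hq hq4 hm hn hgen ht⟩
  refine Set.infinite_of_forall_exists_gt fun N => ?_
  -- The field is `ZMod p` and $t$ is the translation by $1$; the order $n=p(p-1)m\ge p$ then
  -- exceeds $N$.
  obtain ⟨p, hpN, hp⟩ := Nat.exists_infinite_primes (N + 4)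
  have : Fact p.Prime := ⟨hp⟩
  obtain ⟨s, hs⟩ := IsCyclic.exists_zpow_surjective (G := (ZMod p)ˣ)
  have hgen : Subgroup.zpowers s = ⊤ := (Subgroup.eq_top_iff' _).mpr hs
  have ht : (AffGroup.translation 1 : AffGroup (ZMod p)) ∉
      (SemidirectProduct.inr : (ZMod p)ˣ →* AffGroup (ZMod p)).range := by
    rintro ⟨u, hu⟩
    have h : (0 : ZMod p) = 1 := congrArg (fun g => g.left.toAdd) hu
    exact zero_ne_one h
  obtain ⟨hcard, hconn, hdeg, -, hmult⟩ := affinePathGraph_spec (ZMod p) p _ _ s _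
    (ZMod.card p).symm (by omega) rfl rfl hgen ht
  have hm := (pathLength_add_two (show 4 ≤ p by omega)).1
  let G := affinePathGraph s (AffGroup.translation 1) (pathLength p)
  let e : G ≃g G.overFin hcard := G.overFinIso hcard
  refine ⟨p * (p - 1) * pathLength p, ⟨G.overFin hcard, e.connected_iff.mp hconn,
    (graphMaxDegree_congr e).symm.trans hdeg, ?_⟩, ?_⟩
  · rw [← secondEigenvalueMultiplicity_congr e]
    exact hmult
  · have : (N + 4) * 1 * 1 ≤ p * (p - 1) * pathLength p :=
      Nat.mul_le_mul (Nat.mul_le_mul hpN (by omega)) (by omega)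
    omega
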